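/- Throughout, $B(x,r)=\{y\in\mathbb R^d:\|y-x\|\le r\}$ is the closed Euclidean ball, $B^\circ(x,r)$ the open one, samples are counted with multiplicity, and $p$ is a Borel probability measure on $\mathbb R^d$, $d\ge 1$. **Copy rates.** Given a sample $S=(x_1,\dots,x_n)$ and a probability measure $q$, a point $x'$ is a $(\lambda,\gamma)$-copy of $x_i$ if there is a ball $B$ centred at $x_i$ with $x'\in B$, $q(B)\ge\lambda p(B)$ and $p(B)\le\gamma$. Let $cr(q,\lambda,\gamma)$ be the $q$-mass of the set of points that are $(\lambda,\gamma)$-copies of some $x_i$, and put $cr_q^{-\epsilon}=cr(q,\lambda(1+\epsilon),\gamma(1+\epsilon)^{-1})$, $cr_q^{\epsilon}=cr(q,\lambda(1+\epsilon)^{-1},\gamma(1+\epsilon))$. **Regularity.** For an integer $k>0$, $p$ is $k$-regular if for every $\epsilon>0$ there is a constant $0<p_\epsilon\le 1$ such that for all $x\in\operatorname{supp}p$ and $0<s<r$ with $p(B(x,r))\le p_\epsilon$, $$\Big(1+\frac\epsilon3\Big)^{-1}\frac{r^k}{s^k}\le\frac{p(B(x,r))}{p(B(x,s))}\le\Big(1+\frac\epsilon3\Big)\frac{r^k}{s^k}.$$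 It is regular if it is $k$-regular for some $k$. **Detectors.** A generative algorithm $A$ is a (possibly randomized) procedure that maps a sample $S$ to a random probability measure $q\sim A(S)$ on $\mathbb R^d$ (a Markov kernel). A data-copying detector is an algorithm that computes an estimate $D(S,q)$ of the data-copy rate from $S$ and i.i.d. oracle samples from $q$; it also has access to $\lambda,\gamma$. **Algorithm Data_Copy_Detect** (with inputs $k,\epsilon,\delta,\lambda,\gamma$ and constants $c_1,c_2$). Put $$b=\Big\lceil c_1\frac{d\ln(n/\delta)}{\epsilon^2}\Big\rceil,\quad m=\Big\lceil c_2\frac{dn^2\ln\frac{nd}{\delta\epsilon}}{\epsilon^4}\Big\rceil,\quad u=\Big\lceil\frac{20\ln(6/\delta)}{\epsilon^2}\Big\rceil .$$ With $r_*=\min\{s>0:|S\cap B(x,s)|=b\}$, let $Est(x,r,S)=\frac{b\,r^k}{n\,r_*^k}$ if $r_*>r$ and $Est(x,r,S)=\frac{|S\cap B(x,r)|}n$ otherwise. Draw $T\sim q^m$. For each $i$ put $p_i(r)=Est(x_i,r,S)$, $q_i(r)=|B(x_i,r)\cap T|/m$, and let $r_i^*$ be the largest $r\in\{\|z-x_i\|:z\in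 T\}\cup\{0\}$ with $p_i(r)\le\gamma$ and $q_i(r)\ge\lambda p_i(r)$ (the ball is empty if there is none). Draw a fresh sample $U\sim q^{u}$ and return the fraction of $U$ that lies in $\bigcup_i B(x_i,r_i^*)$. **Theorem.** There are absolute constants $c_1,c_2,C>0$ such that the following holds for all $d\ge1$ and $k\geq 1$, every $k$-regular $p$ on $\mathbb R^d$, all $\epsilon,\delta>0$ and every admissible constant $p_\epsilon$ in the definition of $k$-regularity. Assume that $p_\epsilon$ meets the no-ties condition: for $p$-almost every $x$ and all $r\ge0$ with $p(B^\circ(x,r))<p_\epsilon$, the sphere $\{y:\|y-x\|=r\}$ is $p$-null. Then Data_Copy_Detect is a data-copying detector whose sample complexity with respect to $p$ is at most $$C\,\frac{d\,\ln\frac{d}{\delta\,\epsilon\,p_\epsilon}}{\epsilon^2\,p_\epsilon}.$$ That is, for every integer $n\ge 0$ that is at least this quantity, all $\lambda>1$, all $0<\gamma<1$ and every generative algorithm $A$, with probability at least $1-\delta$ over $S\sim p^n$, $q\sim A(S)$ and the oracle samples $T,U$ drawn from $q$, $$cr_q^{-\epsilon}-\epsilon\;\le\;D(S,q)\;\le\;cr_q^{\epsilon}+\epsilon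 .$$ -/

import Mathlib

open MeasureTheory ProbabilityTheory

noncomputable section

namespace DataCopying

/-- The data space `ℝ^d` with the Euclidean norm. -/
abbrev Euc (d : ℕ) : Type := EuclideanSpace ℝ (Fin d)

variable {d : ℕ}

/-! ### Data copying -/

/-- `x'` is a `(lam, gam)`-copy of `x`: some closed ball `B` around `x` contains `x'` and satisfies
`q(B) ≥ lam * p(B)` and `p(B) ≤ gam`. -/
def IsCopy (p q : Measure (Euc d)) (lam gam : ℝ) (x x' : Euc d) : Prop :=
  ∃ r : ℝ, x' ∈ Metric.closedBall x r ∧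
    lam * p.real (Metric.closedBall x r) ≤ q.real (Metric.closedBall x r) ∧
    p.real (Metric.closedBall x r) ≤ gam

/-- The data-copy rate `cr(q, lam, gam)` of `q` with respect to `p` and the training sample `S`:
the `q`-probability of being a copy of some training point. -/
def copyRate {n : ℕ} (p : Measure (Euc d)) (S : Fin n → Euc d) (q : Measure (Euc d))
    (lam gam : ℝ) : ℝ :=
  q.real {x' | ∃ i, IsCopy p q lam gam (S i) x'}

/-- The lower approximate data-copy rate `cr_q^{-ε}`. -/
def copyRateLower {n : ℕ} (p : Measure (Euc d)) (S : Fin n → Euc d) (q : Measure (Euc d))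
    (lam gam ε : ℝ) : ℝ :=
  copyRate p S q (lam * (1 + ε)) (gam * (1 + ε)⁻¹)

/-- The upper approximate data-copy rate `cr_q^{ε}`. -/
def copyRateUpper {n : ℕ} (p : Measure (Euc d)) (S : Fin n → Euc d) (q : Measure (Euc d))
    (lam gam ε : ℝ) : ℝ :=
  copyRate p S q (lam * (1 + ε)⁻¹) (gam * (1 + ε))

/-! ### Regular distributions -/

/-- `c` is an admissible value of the constant `p_ε` for the (probability) distribution `p`
and the exponent `k`. -/
def IsRegularityConstant (p : Measure (Euc d)) (k : ℕ) (ε c : ℝ) : Prop :=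
  0 < c ∧ c ≤ 1 ∧ ∀ x ∈ p.support, ∀ s r : ℝ, 0 < s → s < r →
    p.real (Metric.closedBall x r) ≤ c →
      (1 + ε / 3)⁻¹ * (r ^ k / s ^ k) ≤
          p.real (Metric.closedBall x r) / p.real (Metric.closedBall x s) ∧
        p.real (Metric.closedBall x r) / p.real (Metric.closedBall x s) ≤
          (1 + ε / 3) * (r ^ k / s ^ k)

/-- `p` is `k`-regular. -/
def IsKRegular (p : Measure (Euc d)) (k : ℕ) : Prop :=
  0 < k ∧ ∀ ε : ℝ, 0 < ε → ∃ c : ℝ, IsRegularityConstant p k ε c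

/-- Around `p`-almost every point, every sphere (including the degenerate one of radius `0`) whose
open ball has mass less than `c` is `p`-null.  This says that, almost surely, the numbers
`|S ∩ B(x, s)|` for `x ∈ S` have no jumps larger than one as long as the mass is below `c`. -/
def HasNullSpheresBelow (p : Measure (Euc d)) (c : ℝ) : Prop :=
  ∀ᵐ x ∂p, ∀ r : ℝ, 0 ≤ r → p.real (Metric.ball x r) < c → p (Metric.sphere x r) = 0

/-! ### Generative algorithms, detectors and sample complexity -/

/-- A (randomized) generative algorithm: given a training sample `S` of any size `n`, it outputs a
random probability distribution `q ∼ A(S)` on `ℝ^d`. -/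
structure GenerativeAlgorithm (d : ℕ) where
  law : ∀ n : ℕ, Kernel (Fin n → Euc d) (ProbabilityMeasure (Euc d))
  isMarkov : ∀ n : ℕ, IsMarkovKernel (law n)

instance (A : GenerativeAlgorithm d) (n : ℕ) : IsMarkovKernel (A.law n) := A.isMarkov n

theorem measurable_iid (N : ℕ) :
    Measurable (fun q : ProbabilityMeasure (Euc d) =>
      Measure.pi (fun _ : Fin N => (q : Measure (Euc d)))) := by
  refine Measurable.measure_of_isPiSystem_of_isProbabilityMeasure
    (S := Set.pi Set.univ '' Set.pi Set.univ fun _ : Fin N => {s : Set (Euc d) | MeasurableSet s})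
    generateFrom_pi.symm isPiSystem_pi ?_
  rintro _ ⟨s, hs, rfl⟩
  simp only [Measure.pi_pi]
  refine Finset.measurable_prod _ fun i _ => ?_
  have hi : MeasurableSet (s i) := hs i (Set.mem_univ i)
  exact (Measure.measurable_coe hi).comp measurable_subtype_coe

/-- The kernel `q ↦ q^N`: `N` independent calls to the sampling oracle of `q`. -/
def iidKernel (d N : ℕ) : Kernel (ProbabilityMeasure (Euc d)) (Fin N → Euc d) where
  toFun q := Measure.pi (fun _ : Fin N => (q : Measure (Euc d)))
  measurable' := measurable_iid N

instance (N : ℕ) : IsMarkovKernel (iidKernel d N) where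
  isProbabilityMeasure q :=
    inferInstanceAs (IsProbabilityMeasure (Measure.pi fun _ : Fin N => (q : Measure (Euc d))))

/-- The joint law of the training sample `S ∼ p^n`, the generated distribution `q ∼ A(S)` and
`N` oracle samples drawn independently from `q`. -/
def trialLaw (p : Measure (Euc d)) (A : GenerativeAlgorithm d) (n N : ℕ) :
    Measure (((Fin n → Euc d) × ProbabilityMeasure (Euc d)) × (Fin N → Euc d)) :=
  ((Measure.pi fun _ : Fin n => p) ⊗ₘ A.law n) ⊗ₘ
    ((iidKernel d N).comap Prod.snd measurable_snd)

instance (p : Measure (Euc d)) [IsProbabilityMeasure p] (A : GenerativeAlgorithm d) (n N : ℕ) :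
    IsProbabilityMeasure (trialLaw p A n N) := by
  unfold trialLaw
  infer_instance

/-- A data-copying detector: from the training sample `S` and samples from the oracle for `q` it
computes an estimate of the data-copy rate.  `draws n` is the number of oracle calls that it makes
on a training sample of size `n`.  It has no other access to `p` or `q`. -/
structure DataCopyDetector (d : ℕ) where
  draws : ℕ → ℕ
  estimate : ∀ n : ℕ, (Fin n → Euc d) → (Fin (draws n) → Euc d) → ℝ

/-- The event that the detector's output lies outside
`[cr_q^{-ε} - ε, cr_q^{ε} + ε]`. -/
def failureEvent (p : Measure (Euc d)) (D : DataCopyDetector d) (lam gam ε : ℝ) (n : ℕ) :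
    Set (((Fin n → Euc d) × ProbabilityMeasure (Euc d)) × (Fin (D.draws n) → Euc d)) :=
  {ω | ¬ (copyRateLower p ω.1.1 ω.1.2 lam gam ε - ε ≤ D.estimate n ω.1.1 ω.2 ∧
    D.estimate n ω.1.1 ω.2 ≤ copyRateUpper p ω.1.1 ω.1.2 lam gam ε + ε)}

/-- The detector `D` (which has access to the parameters `lam` and `gam`) has sample complexity at
most `M` with respect to `p`, at tolerances `ε` and `δ`.  The (outer) probability of failure is
bounded by `δ`, so that the output is accurate with probability at least `1 - δ`. -/
def SampleComplexityAtMost (D : ℝ → ℝ → DataCopyDetector d) (p : Measure (Euc d))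
    (ε δ M : ℝ) : Prop :=
  ∀ n : ℕ, M ≤ n → ∀ lam gam : ℝ, 1 < lam → 0 < gam → gam < 1 →
    ∀ A : GenerativeAlgorithm d,
      trialLaw p A n ((D lam gam).draws n) (failureEvent p (D lam gam) lam gam ε n) ≤
        ENNReal.ofReal δ

/-! ### The algorithm -/

open Classical in
/-- `|S ∩ B(x, r)|`, counted with multiplicity. -/
def ballCount {n : ℕ} (S : Fin n → Euc d) (x : Euc d) (r : ℝ) : ℕ :=
  (Finset.univ.filter fun i => S i ∈ Metric.closedBall x r).card

/-- `r_* = min {s > 0 : |S ∩ B(x, s)| = b}`. -/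
def anchorRadius {n : ℕ} (b : ℕ) (S : Fin n → Euc d) (x : Euc d) : ℝ :=
  sInf {s : ℝ | 0 < s ∧ ballCount S x s = b}

open Classical in
/-- The subroutine `Est(x, r, S)`, for a `k`-regular distribution and with anchor count `b`. -/
def est {n : ℕ} (k b : ℕ) (S : Fin n → Euc d) (x : Euc d) (r : ℝ) : ℝ :=
  if r < anchorRadius b S x then (b * r ^ k) / (n * anchorRadius b S x ^ k)
  else (ballCount S x r : ℝ) / n

open Classical in
/-- The radii `‖z - x‖`, `z ∈ T`, and `0`. -/
def radii {m : ℕ} (T : Fin m → Euc d) (x : Euc d) : Finset ℝ :=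
  insert 0 (Finset.univ.image fun j => ‖T j - x‖)

open Classical in
/-- `r_i^*`, the largest of the radii `r` with `p_i(r) ≤ gam` and `q_i(r) ≥ lam * p_i(r)`
(`⊥`, with empty ball, if there is none). -/
def copyRadius {n m : ℕ} (k b : ℕ) (lam gam : ℝ) (S : Fin n → Euc d) (T : Fin m → Euc d)
    (i : Fin n) : WithBot ℝ :=
  ((radii T (S i)).filter fun r => est k b S (S i) r ≤ gam ∧
    lam * est k b S (S i) r ≤ (ballCount T (S i) r : ℝ) / m).max

open Classical in
/-- The output `|V| / |U|`, where `V` is the part of `U` in the union of the balls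
`B(x_i, r_i^*)`. -/
def detectOutput {n m u : ℕ} (k b : ℕ) (lam gam : ℝ) (S : Fin n → Euc d) (T : Fin m → Euc d)
    (U : Fin u → Euc d) : ℝ :=
  ((Finset.univ.filter fun j =>
    ∃ i, ((‖U j - S i‖ : ℝ) : WithBot ℝ) ≤ copyRadius k b lam gam S T i).card : ℝ) / u

/-- The anchor count `b = O(d ln(n/δ) / ε²)` with constant `c`. -/
def anchorCount (c : ℝ) (d : ℕ) (ε δ : ℝ) (n : ℕ) : ℕ :=
  ⌈c * (d * Real.log (n / δ) / ε ^ 2)⌉₊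

/-- The size `m = O(d n² ln(nd/(δε)) / ε⁴)` of `T`, with constant `c`. -/
def searchSize (c : ℝ) (d : ℕ) (ε δ : ℝ) (n : ℕ) : ℕ :=
  ⌈c * (d * n ^ 2 * Real.log (n * d / (δ * ε)) / ε ^ 4)⌉₊

/-- The size of `U`. -/
def testSize (ε δ : ℝ) : ℕ :=
  ⌈20 * Real.log (6 / δ) / ε ^ 2⌉₊

/-- The algorithm `Data_Copy_Detect`, for `k`-regular distributions on `ℝ^d`, with tolerances `ε`
and `δ`; `c₁` and `c₂` are the constants in the choice of `b` and of `m`.  The first `m` oracle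
samples form `T`, the fresh remaining ones form `U`. -/
def dataCopyDetect (d : ℕ) (c₁ c₂ : ℝ) (k : ℕ) (ε δ lam gam : ℝ) : DataCopyDetector d where
  draws n := searchSize c₂ d ε δ n + testSize ε δ
  estimate n S ω :=
    detectOutput k (anchorCount c₁ d ε δ n) lam gam S
      (fun j : Fin (searchSize c₂ d ε δ n) => ω (Fin.castAdd (testSize ε δ) j))
      (fun j : Fin (testSize ε δ) => ω (Fin.natAdd (searchSize c₂ d ε δ n) j))

end DataCopying

end

namespace DataCopying

/-! The output is correct once three estimates hold: `est` is accurate up to a factor near 1 on all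
balls around training points, the frequencies of T are accurate on these balls up to an additive
error of order ε²/n, and U estimates the q-mass of the region found by the search up to ε/2. Each
fails with probability at most δ/3.

Uniformity over radii needs no VC theory. By monotonicity it suffices to control balls around a
sample point whose boundary passes through a sample point (`abs_ballCount_sub_le`). Such a ball
depends on at most two sample points. Replacing these by constants preserves the law after averaging
and moves the count by at most 2, so Chernoff's bound for a fixed set applies
(`chernoff_two_point`), followed by a union bound.

Counts of at least b are accurate in the relative sense. Below the anchor radius `est` extrapolates
by the power law, and regularity bounds the error because the anchor ball has mass at most the
regularity constant (`est_approx`). The no-ties condition makes small counts grow one by one almost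
surely, so the count b is attained (`anchorRadius_spec`).

In `region_bounds`, balls of q-mass below τ = ε/(4n) are written off; on heavier balls the additive
error of T is a relative one. Each training point costs at most 2τ, in total ε/2. The other ε/2
comes from U, which is independent of the region once S and q are given.

The required sample size is useful only if its logarithm is bounded below. For d ≥ 2 it is at least
ln 2. For d = 1 and ε ≤ 1 the hypotheses are contradictory (`not_isRegularityConstant_dim_one`). The
cases ε ≥ 1 and δ ≥ 1 are trivial. -/

open Classical in
/-- The number of sample points in `B`, counted with multiplicity. -/
noncomputable def hitCount {α : Type*} {n : ℕ} (S : Fin n → α) (B : Set α) : ℕ :=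
  (Finset.univ.filter fun i => S i ∈ B).card

theorem ballCount_eq_hitCount {d n : ℕ} (S : Fin n → Euc d) (x : Euc d) (r : ℝ) :
    ballCount S x r = hitCount S (Metric.closedBall x r) := rfl

theorem hitCount_le {α : Type*} {n : ℕ} (S : Fin n → α) (B : Set α) : hitCount S B ≤ n := by
  classical
  simpa [hitCount] using Finset.card_le_univ (Finset.univ.filter fun i => S i ∈ B)

theorem hitCount_mono {α : Type*} {n : ℕ} (S : Fin n → α) {B B' : Set α} (h : B ⊆ B') :
    hitCount S B ≤ hitCount S B' := by
  classical
  unfold hitCount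
  exact Finset.card_le_card fun i hi => by
    simp only [Finset.mem_filter, Finset.mem_univ, true_and] at hi ⊢
    exact h hi

theorem hitCount_congr {α : Type*} {n : ℕ} (S : Fin n → α) {B B' : Set α}
    (h : ∀ i, S i ∈ B ↔ S i ∈ B') : hitCount S B = hitCount S B' := by
  classical
  unfold hitCount
  congr 1
  ext i
  simp [h]

theorem hitCount_eq_sum {α : Type*} {n : ℕ} (S : Fin n → α) (B : Set α) :
    (hitCount S B : ℝ) = ∑ i, B.indicator (fun _ => (1 : ℝ)) (S i) := by
  classical
  simp [hitCount, Set.indicator_apply, Finset.sum_boole]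

theorem abs_hitCount_update_sub_le {α : Type*} {n : ℕ} (S : Fin n → α) (i : Fin n) (x : α)
    (B : Set α) :
    |(hitCount (Function.update S i x) B : ℝ) - hitCount S B| ≤ 1 := by
  rw [hitCount_eq_sum, hitCount_eq_sum, ← Finset.sum_sub_distrib,
    Finset.sum_eq_single i (fun j _ hj => by simp [Function.update_of_ne hj])
      (fun h => absurd (Finset.mem_univ i) h)]
  simp only [Function.update_self]
  by_cases h1 : x ∈ B <;> by_cases h2 : S i ∈ B <;> simp [h1, h2]

/-! ### Chernoff bounds for a fixed set -/

section Chernoff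

variable {α : Type*} [MeasurableSpace α] (p : Measure α) [IsProbabilityMeasure p]

theorem measurable_hitCount {Ω : Type*} [MeasurableSpace Ω] {n : ℕ} {S : Ω → Fin n → α}
    {V : Set (Ω × α)} (hV : MeasurableSet V) (hS : Measurable S) :
    Measurable fun ω => (hitCount (S ω) {z | (ω, z) ∈ V} : ℝ) := by
  simp only [hitCount_eq_sum]
  refine Finset.measurable_sum _ fun i _ => ?_
  have : (fun ω => Set.indicator {z | (ω, z) ∈ V} (fun _ => (1 : ℝ)) (S ω i)) =
      Set.indicator {ω | (ω, S ω i) ∈ V} (fun _ => (1 : ℝ)) := by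
    ext ω
    rfl
  rw [this]
  refine measurable_const.indicator ?_
  exact (measurable_id.prodMk ((measurable_pi_apply i).comp hS)) hV

/-- Markov's inequality for the exponential moment of the count, with e^t - 1 ≤ t + t² for |t| ≤ 1.
The sign of t selects the tail. -/
theorem chernoff {n : ℕ} {B : Set α} (hB : MeasurableSet B) {t : ℝ} (ht : |t| ≤ 1) (s : ℝ) :
    (Measure.pi fun _ : Fin n => p) {S | s ≤ t * (hitCount S B - n * p.real B)} ≤
      ENNReal.ofReal (Real.exp (-s + n * p.real B * t ^ 2)) := by
  set f : α → ℝ := fun x => Real.exp (t * B.indicator (fun _ => (1 : ℝ)) x) with hf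
  have hf' : f = fun x => 1 + B.indicator (fun _ => Real.exp t - 1) x := by
    ext x
    by_cases hx : x ∈ B <;> simp [hf, hx]
  have hfint : ∫ x, f x ∂p = 1 + p.real B * (Real.exp t - 1) := by
    rw [hf', integral_add (integrable_const _) ((integrable_const _).indicator hB),
      integral_indicator_const _ hB]
    simp
  have hfi : Integrable f p := by
    rw [hf']
    exact (integrable_const _).add ((integrable_const _).indicator hB)
  have hprod : ∀ S : Fin n → α, ∏ i, f (S i) = Real.exp (t * hitCount S B) := by
    intro S
    rw [hitCount_eq_sum, Finset.mul_sum, Real.exp_sum]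
  have hint : ∫ S, ∏ i, f (S i) ∂(Measure.pi fun _ : Fin n => p) =
      (1 + p.real B * (Real.exp t - 1)) ^ n := by
    rw [integral_fintype_prod_eq_pow, hfint, Fintype.card_fin]
  have hP0 : 0 ≤ p.real B := measureReal_nonneg
  have hexp : Real.exp t - 1 ≤ t + t ^ 2 := by
    have := (abs_le.1 (Real.abs_exp_sub_one_sub_id_le ht)).2
    linarith
  have hbase : (1 + p.real B * (Real.exp t - 1)) ^ n ≤
      Real.exp (n * p.real B * (t + t ^ 2)) := by
    have h0 : 0 ≤ 1 + p.real B * (Real.exp t - 1) := by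
      rw [← hfint]
      exact integral_nonneg fun x => (Real.exp_pos _).le
    have h1 : 1 + p.real B * (Real.exp t - 1) ≤ Real.exp (p.real B * (t + t ^ 2)) := by
      have := Real.add_one_le_exp (p.real B * (t + t ^ 2))
      have := mul_le_mul_of_nonneg_left hexp hP0
      linarith
    calc _ ≤ Real.exp (p.real B * (t + t ^ 2)) ^ n := pow_le_pow_left₀ h0 h1 n
      _ = _ := by rw [← Real.exp_nat_mul]; ring_nf
  have hmarkov := mul_meas_ge_le_integral_of_nonneg
    (μ := Measure.pi fun _ : Fin n => p) (f := fun S => ∏ i, f (S i))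
    (ae_of_all _ fun S => Finset.prod_nonneg fun i _ => (Real.exp_pos _).le)
    (Integrable.fintype_prod fun _ => hfi) (Real.exp (s + t * (n * p.real B)))
  rw [hint] at hmarkov
  have hset : {S : Fin n → α | s ≤ t * (hitCount S B - n * p.real B)} =
      {S | Real.exp (s + t * (n * p.real B)) ≤ ∏ i, f (S i)} := by
    ext S
    simp only [Set.mem_ofPred_eq, hprod, Real.exp_le_exp]
    constructor <;> intro h <;> linarith
  rw [hset, ← ofReal_measureReal]
  apply ENNReal.ofReal_le_ofReal
  have h2 : -s + n * p.real B * t ^ 2 =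
      n * p.real B * (t + t ^ 2) - (s + t * (n * p.real B)) := by ring
  rw [h2, Real.exp_sub, le_div_iff₀ (Real.exp_pos _), mul_comm]
  exact hmarkov.trans hbase

/-- Multiplicative Chernoff bound, in both directions. -/
theorem chernoff_deviation {n : ℕ} {B : Set α} (hB : MeasurableSet B) {σ η M : ℝ} (hσ : |σ| = 1)
    (hη : 0 ≤ η) (hη2 : η ≤ 2) (hM : n * p.real B ≤ M) :
    (Measure.pi fun _ : Fin n => p) {S | η * M ≤ σ * (hitCount S B - n * p.real B)} ≤
      ENNReal.ofReal (Real.exp (-(η ^ 2 * M / 4))) := by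
  have hσ2 : σ ^ 2 = 1 := by rw [← sq_abs, hσ, one_pow]
  have ht : |σ * (η / 2)| ≤ 1 := by
    rw [abs_mul, hσ, one_mul, abs_of_nonneg (by positivity)]
    linarith
  -- With t = ση/2 the exponent is -η²M/2 plus a variance term that is at most η²M/4.
  refine (measure_mono fun S hS => ?_).trans
    ((chernoff p hB ht (η / 2 * (η * M))).trans (ENNReal.ofReal_le_ofReal (Real.exp_le_exp.2 ?_)))
  · have hS' : η * M ≤ σ * (hitCount S B - n * p.real B) := hS
    show η / 2 * (η * M) ≤ σ * (η / 2) * (hitCount S B - n * p.real B)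
    have := mul_le_mul_of_nonneg_left hS' (by positivity : 0 ≤ η / 2)
    linarith
  · have : (σ * (η / 2)) ^ 2 = η ^ 2 / 4 := by rw [mul_pow, hσ2]; ring
    rw [this]
    have := mul_le_mul_of_nonneg_right hM (by positivity : 0 ≤ η ^ 2 / 4)
    linarith

end Chernoff

/-! ### Resampling: sets that depend on the sample -/

section Resampling

variable {α : Type*} [MeasurableSpace α] (p : Measure α) [IsProbabilityMeasure p]

theorem measurable_update_prod {n : ℕ} (i : Fin n) :
    Measurable fun w : (Fin n → α) × α => Function.update w.1 i w.2 := by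
  refine measurable_pi_lambda _ fun j => ?_
  by_cases h : j = i
  · subst h
    simpa using measurable_snd
  · simpa [Function.update_of_ne h, Function.comp_def] using
      (measurable_pi_apply j).comp measurable_fst

/-- Replacing one coordinate of an i.i.d. sample by a fresh draw does not change its law. -/
theorem measurePreserving_update {n : ℕ} (i : Fin n) :
    MeasurePreserving (fun w : (Fin n → α) × α => Function.update w.1 i w.2)
      ((Measure.pi fun _ => p).prod p) (Measure.pi fun _ => p) := by
  refine ⟨measurable_update_prod i, (Measure.pi_eq fun s hs => ?_).symm⟩
  rw [Measure.map_apply (measurable_update_prod i) (MeasurableSet.univ_pi hs)]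
  have : (fun w : (Fin n → α) × α => Function.update w.1 i w.2) ⁻¹' Set.univ.pi s =
      (Set.univ.pi (Function.update s i Set.univ)) ×ˢ s i := by
    ext w
    simp only [Set.mem_preimage, Set.mem_univ_pi, Set.mem_prod]
    constructor
    · intro h
      refine ⟨fun j => ?_, by simpa using h i⟩
      by_cases hj : j = i
      · subst hj; simp
      · simpa [Function.update_of_ne hj] using h j
    · rintro ⟨h, h'⟩ j
      by_cases hj : j = i
      · subst hj; simpa using h'
      · simpa [Function.update_of_ne hj] using h j
  rw [this, Measure.prod_prod, Measure.pi_pi, ← Finset.mul_prod_erase _ _ (Finset.mem_univ i),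
    ← Finset.mul_prod_erase _ _ (Finset.mem_univ i)]
  simp only [Function.update_self, measure_univ, one_mul]
  rw [mul_comm]
  congr 1
  refine Finset.prod_congr rfl fun j hj => ?_
  rw [Function.update_of_ne (Finset.ne_of_mem_erase hj)]

/-- Invariance of the law under resampling, with Fubini over the fresh draw: one coordinate may be
frozen at an arbitrary value. -/
theorem pi_le_of_forall_update {n : ℕ} (i : Fin n) {E : Set (Fin n → α)} (hE : MeasurableSet E)
    {c : ENNReal} (h : ∀ x, (Measure.pi fun _ => p) {S | Function.update S i x ∈ E} ≤ c) :
    (Measure.pi fun _ => p) E ≤ c := by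
  rw [← (measurePreserving_update p i).measure_preimage hE.nullMeasurableSet,
    Measure.prod_apply_symm (measurable_update_prod i hE)]
  calc _ ≤ ∫⁻ _, c ∂p := lintegral_mono fun x => h x
    _ = c := by simp

/-- Concatenation of two independent i.i.d. samples. -/
theorem measurePreserving_append (m u : ℕ) :
    MeasurePreserving (fun w : (Fin m → α) × (Fin u → α) => Fin.append w.1 w.2)
      ((Measure.pi fun _ => p).prod (Measure.pi fun _ => p)) (Measure.pi fun _ => p) := by
  have hm : Measurable fun w : (Fin m → α) × (Fin u → α) => Fin.append w.1 w.2 := by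
    refine measurable_pi_lambda _ fun j => ?_
    refine Fin.addCases (fun j => ?_) (fun j => ?_) j
    · simpa [Function.comp_def] using (measurable_pi_apply j).comp measurable_fst
    · simpa [Function.comp_def] using (measurable_pi_apply j).comp measurable_snd
  refine ⟨hm, (Measure.pi_eq fun s hs => ?_).symm⟩
  rw [Measure.map_apply hm (MeasurableSet.univ_pi hs)]
  have : (fun w : (Fin m → α) × (Fin u → α) => Fin.append w.1 w.2) ⁻¹' Set.univ.pi s =
      (Set.univ.pi fun j => s (Fin.castAdd u j)) ×ˢ (Set.univ.pi fun j => s (Fin.natAdd m j)) := by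
    ext w
    simp only [Set.mem_preimage, Set.mem_univ_pi, Set.mem_prod]
    constructor
    · intro h
      exact ⟨fun j => by simpa using h (Fin.castAdd u j), fun j => by simpa using h (Fin.natAdd m j)⟩
    · rintro ⟨h, h'⟩ j
      refine Fin.addCases (fun j => ?_) (fun j => ?_) j
      · simpa using h j
      · simpa using h' j
  rw [this, Measure.prod_prod, Measure.pi_pi, Measure.pi_pi, Fin.prod_univ_add]

/-- Chernoff bound for a set that depends on two of the sample points. -/
theorem chernoff_two_point {n : ℕ} {V : Set ((α × α) × α)} (hV : MeasurableSet V) (i j : Fin n)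
    {σ η b : ℝ} (hσ : |σ| = 1) (hη : 0 ≤ η) (hη2 : η ≤ 2) (hb : 4 ≤ η * b) :
    (Measure.pi fun _ : Fin n => p)
      {S | η * max (n * p.real {z | ((S i, S j), z) ∈ V}) b <
        σ * (hitCount S {z | ((S i, S j), z) ∈ V} - n * p.real {z | ((S i, S j), z) ∈ V})} ≤
      ENNReal.ofReal (Real.exp (-(η ^ 2 * b / 16))) := by
  have hreal : Measurable fun w : α × α => p.real {z | (w, z) ∈ V} :=
    (measurable_measure_prodMk_left hV).ennreal_toReal
  have hij : Measurable fun S : Fin n → α => (S i, S j) :=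
    (measurable_pi_apply i).prodMk (measurable_pi_apply j)
  have hP : Measurable fun S : Fin n → α => p.real {z | ((S i, S j), z) ∈ V} := hreal.comp hij
  have hN : Measurable fun S : Fin n → α => (hitCount S {z | ((S i, S j), z) ∈ V} : ℝ) :=
    measurable_hitCount (V := {w : (Fin n → α) × α | ((w.1 i, w.1 j), w.2) ∈ V})
      (((hij.comp measurable_fst).prodMk measurable_snd) hV) measurable_id
  have hE := measurableSet_lt ((((hP.const_mul (n : ℝ)).max measurable_const).const_mul η))
    ((hN.sub (hP.const_mul (n : ℝ))).const_mul σ) (g := fun S : Fin n → α =>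
      σ * ((hitCount S {z | ((S i, S j), z) ∈ V} : ℝ) - n * p.real {z | ((S i, S j), z) ∈ V}))
      (f := fun S : Fin n → α => η * max (n * p.real {z | ((S i, S j), z) ∈ V}) b)
  refine pi_le_of_forall_update p i hE fun x => ?_
  have hE' : MeasurableSet {S : Fin n → α | Function.update S i x ∈ {S : Fin n → α |
      η * max (n * p.real {z | ((S i, S j), z) ∈ V}) b <
        σ * ((hitCount S {z | ((S i, S j), z) ∈ V} : ℝ) -
          n * p.real {z | ((S i, S j), z) ∈ V})}} :=
    ((measurable_update_prod i).comp (measurable_id.prodMk measurable_const)) hE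
  refine pi_le_of_forall_update p j hE' fun y => ?_
  -- The value of coordinate j after both updates: x if i = j, and y otherwise.
  obtain ⟨a, ha⟩ : ∃ a, ∀ S : Fin n → α,
      (Function.update (Function.update S j y) i x i = x ∧
        Function.update (Function.update S j y) i x j = a) := by
    by_cases h : j = i
    · subst h; exact ⟨x, fun S => by simp⟩
    · exact ⟨y, fun S => by simp [Function.update_of_ne h]⟩
  set B : Set α := {z | ((x, a), z) ∈ V} with hBdef
  have hB : MeasurableSet B := measurable_prodMk_left hV
  set M : ℝ := max (n * p.real B) b with hM
  have hMb : b ≤ M := le_max_right _ _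
  refine (measure_mono fun S hS => ?_).trans
    ((chernoff_deviation p hB (n := n) (η := η / 2) (M := M) hσ (by positivity) (by linarith)
      (le_max_left _ _)).trans (ENNReal.ofReal_le_ofReal (Real.exp_le_exp.2 ?_)))
  · simp only [Set.mem_ofPred_eq, (ha S).1, (ha S).2] at hS
    rw [← hBdef, ← hM] at hS
    show η / 2 * M ≤ σ * (hitCount S B - n * p.real B)
    have h1 := abs_hitCount_update_sub_le S j y B
    have h2 := abs_hitCount_update_sub_le (Function.update S j y) i x B
    set N2 : ℝ := (hitCount (Function.update (Function.update S j y) i x) B : ℝ)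
    set N1 : ℝ := (hitCount (Function.update S j y) B : ℝ)
    -- The two replacements cost at most 2, which is at most ηM/2 because ηb ≥ 4. A deviation of
    -- ηM/2 remains for the fixed set.
    have h3 : σ * (N2 - hitCount S B) ≤ 2 := by
      calc σ * (N2 - hitCount S B) ≤ |σ * (N2 - hitCount S B)| := le_abs_self _
        _ = |N2 - hitCount S B| := by rw [abs_mul, hσ, one_mul]
        _ ≤ |N2 - N1| + |N1 - hitCount S B| := abs_sub_le _ _ _
        _ ≤ 2 := by linarith
    have h4 : η * b ≤ η * M := mul_le_mul_of_nonneg_left hMb hη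
    have h5 : σ * (N2 - n * p.real B) =
      σ * (hitCount S B - n * p.real B) + σ * (N2 - hitCount S B) := by ring
    linarith
  · have := mul_le_mul_of_nonneg_left hMb (by positivity : 0 ≤ η ^ 2 / 16)
    have e : (η / 2) ^ 2 * M / 4 = η ^ 2 / 16 * M := by ring
    rw [e]
    linarith

/-- Chernoff bound for a set that depends on one of the sample points. -/
theorem chernoff_one_point {n : ℕ} {V : Set (α × α)} (hV : MeasurableSet V) (j : Fin n)
    {σ η b : ℝ} (hσ : |σ| = 1) (hη : 0 ≤ η) (hη2 : η ≤ 2) (hb : 4 ≤ η * b) :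
    (Measure.pi fun _ : Fin n => p)
      {S | η * max (n * p.real {z | (S j, z) ∈ V}) b <
        σ * (hitCount S {z | (S j, z) ∈ V} - n * p.real {z | (S j, z) ∈ V})} ≤
      ENNReal.ofReal (Real.exp (-(η ^ 2 * b / 16))) :=
  chernoff_two_point p (V := {w | (w.1.2, w.2) ∈ V})
    (((measurable_snd.comp measurable_fst).prodMk measurable_snd) hV) j j hσ hη hη2 hb

end Resampling

variable {d : ℕ}

/-! ### From sample radii to all radii -/

section UniformConvergence

theorem max_sub_max_le {y y' b : ℝ} (h : y ≤ y') : max y' b - max y b ≤ y' - y := by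
  rcases le_total y b with h1 | h1 <;> rcases le_total y' b with h2 | h2 <;>
    simp only [max_eq_left, max_eq_right, h1, h2] <;> linarith

/-- Deviation bounds at the radii of the sample points extend to all radii. -/
theorem abs_ballCount_sub_le {N : ℕ} (Z : Fin N → Euc d) (x : Euc d) (p : Measure (Euc d))
    [IsProbabilityMeasure p] {η b : ℝ} (hη : 0 ≤ η) (hη1 : η ≤ 1) (hb : 0 ≤ b)
    (hU : ∀ j, (hitCount Z (Metric.closedBall x (dist (Z j) x)) : ℝ) -
      N * p.real (Metric.closedBall x (dist (Z j) x)) ≤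
        η * max (N * p.real (Metric.closedBall x (dist (Z j) x))) b)
    (hL : ∀ j, N * p.real (Metric.ball x (dist (Z j) x)) -
      (hitCount Z (Metric.ball x (dist (Z j) x)) : ℝ) ≤
        η * max (N * p.real (Metric.ball x (dist (Z j) x))) b) (r : ℝ) :
    |(ballCount Z x r : ℝ) - N * p.real (Metric.closedBall x r)| ≤
      η * max (N * p.real (Metric.closedBall x r)) b := by
  classical
  have hN : (0 : ℝ) ≤ N := Nat.cast_nonneg N
  have hnn : 0 ≤ η * max (N * p.real (Metric.closedBall x r)) b :=
    mul_nonneg hη (hb.trans (le_max_right _ _))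
  rw [ballCount_eq_hitCount, abs_le]
  constructor
  -- Enlarge r to the next sample radius: the open ball there has the same count, and y - η max(y,
  -- b) is nondecreasing in y since η ≤ 1.
  · by_cases h : ∃ j, r < dist (Z j) x
    · obtain ⟨j0, hj0⟩ := h
      obtain ⟨j, hj, hmin⟩ := Finset.exists_min_image
        (Finset.univ.filter fun j => r < dist (Z j) x) (fun j => dist (Z j) x)
        ⟨j0, by simpa using hj0⟩
      simp only [Finset.mem_filter, Finset.mem_univ, true_and] at hj hmin
      have hcount : hitCount Z (Metric.closedBall x r) =
          hitCount Z (Metric.ball x (dist (Z j) x)) := by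
        refine hitCount_congr Z fun l => ?_
        simp only [Metric.mem_closedBall, Metric.mem_ball]
        constructor
        · intro hl; linarith
        · intro hl
          by_contra hc
          exact absurd (hmin l (not_le.1 hc)) (not_le.2 hl)
      have hmono : p.real (Metric.closedBall x r) ≤ p.real (Metric.ball x (dist (Z j) x)) :=
        measureReal_mono (Metric.closedBall_subset_ball hj)
      have hmono' := mul_le_mul_of_nonneg_left hmono hN
      have h1 := max_sub_max_le (b := b) hmono'
      have h2 := mul_le_mul_of_nonneg_left h1 hη
      have h3 := mul_le_mul_of_nonneg_right hη1 (sub_nonneg.2 hmono')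
      have h4 := hL j
      rw [hcount]
      linarith
    · push Not at h
      have hcount : hitCount Z (Metric.closedBall x r) = N := by
        unfold hitCount
        rw [Finset.filter_true_of_mem (fun j _ => by simpa using h j)]
        simp
      have : N * p.real (Metric.closedBall x r) ≤ N := mul_le_of_le_one_right hN measureReal_le_one
      rw [hcount]
      linarith
  -- Shrink r to the last sample radius: the count stays the same, while the mass and the allowed
  -- error can only decrease.
  · by_cases h : ∃ j, dist (Z j) x ≤ r
    · obtain ⟨j0, hj0⟩ := h
      obtain ⟨j, hj, hmax⟩ := Finset.exists_max_image
        (Finset.univ.filter fun j => dist (Z j) x ≤ r) (fun j => dist (Z j) x)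
        ⟨j0, by simpa using hj0⟩
      simp only [Finset.mem_filter, Finset.mem_univ, true_and] at hj hmax
      have hcount : hitCount Z (Metric.closedBall x r) =
          hitCount Z (Metric.closedBall x (dist (Z j) x)) := by
        refine hitCount_congr Z fun l => ?_
        simp only [Metric.mem_closedBall]
        exact ⟨fun hl => hmax l hl, fun hl => hl.trans hj⟩
      have hmono : p.real (Metric.closedBall x (dist (Z j) x)) ≤ p.real (Metric.closedBall x r) :=
        measureReal_mono (Metric.closedBall_subset_closedBall hj)
      have hmono' := mul_le_mul_of_nonneg_left hmono hN
      have h1 : η * max (N * p.real (Metric.closedBall x (dist (Z j) x))) b ≤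
        η * max (N * p.real (Metric.closedBall x r)) b :=
          mul_le_mul_of_nonneg_left (max_le_max_right _ hmono') hη
      have h4 := hU j
      rw [hcount]
      linarith
    · push Not at h
      have hcount : hitCount Z (Metric.closedBall x r) = 0 := by
        unfold hitCount
        rw [Finset.filter_false_of_mem (fun j _ => by simpa using h j)]
        simp
      have : 0 ≤ N * p.real (Metric.closedBall x r) := by positivity
      rw [hcount]
      push_cast
      linarith

/-- If y < b ≤ N, then the error ηb is at most ηN; otherwise it is already relative to y. -/
theorem relative_of_le_count {N y b η : ℝ} (hη : 0 ≤ η) (hη1 : η ≤ 1) (hb : 0 ≤ b) (hN : b ≤ N)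
    (h : |N - y| ≤ η * max y b) : (1 - η) * N ≤ y ∧ (1 - η) * y ≤ N := by
  rw [abs_le] at h
  rcases le_total b y with h1 | h1
  · rw [max_eq_left h1] at h
    have hy : 0 ≤ y := hb.trans h1
    constructor
    · have := mul_le_mul_of_nonneg_left (show N ≤ (1 + η) * y by linarith)
        (show 0 ≤ 1 - η by linarith)
      nlinarith [mul_nonneg (sq_nonneg η) hy]
    · linarith
  · rw [max_eq_right h1] at h
    have h2 := mul_le_mul_of_nonneg_left hN hη
    constructor
    · linarith
    · have h3 := mul_le_mul_of_nonneg_left (h1.trans hN) (show 0 ≤ 1 - η by linarith)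
      have h4 : 0 ≤ η * N := mul_nonneg hη (hb.trans hN)
      linarith

end UniformConvergence

/-! ### The anchor radius -/

section Anchor

theorem hitCount_closedBall_le_of_unique {n : ℕ} (S : Fin n → Euc d) (x : Euc d) (j : Fin n)
    (h : ∀ l, l ≠ j → dist (S l) x ≠ dist (S j) x) :
    hitCount S (Metric.closedBall x (dist (S j) x)) ≤
      hitCount S (Metric.ball x (dist (S j) x)) + 1 := by
  classical
  unfold hitCount
  refine (Finset.card_le_card (t := insert j
    (Finset.univ.filter fun i => S i ∈ Metric.ball x (dist (S j) x))) fun l hl => ?_).trans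
    (Finset.card_insert_le _ _)
  simp only [Finset.mem_filter, Finset.mem_univ, true_and, Metric.mem_closedBall,
    Finset.mem_insert, Metric.mem_ball] at hl ⊢
  by_cases hlj : l = j
  · exact Or.inl hlj
  · exact Or.inr (lt_of_le_of_ne hl (h l hlj))

/-- If small balls have no ties on their boundary, the minimum in the definition of the anchor
radius is attained. -/
theorem anchorRadius_spec {n : ℕ} (S : Fin n → Euc d) (i : Fin n) {b : ℕ} (hb2 : 2 ≤ b)
    (hbn : b ≤ n)
    (hties : ∀ j, hitCount S (Metric.ball (S i) (dist (S j) (S i))) < b →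
      ∀ l, l ≠ j → dist (S l) (S i) ≠ dist (S j) (S i)) :
    0 < anchorRadius b S (S i) ∧ ballCount S (S i) (anchorRadius b S (S i)) = b := by
  classical
  have hne : (Finset.univ.filter fun j => b ≤ hitCount S
      (Metric.closedBall (S i) (dist (S j) (S i)))).Nonempty := by
    obtain ⟨j, -, hj⟩ := Finset.exists_max_image Finset.univ (fun j => dist (S j) (S i))
      ⟨i, Finset.mem_univ i⟩
    refine ⟨j, ?_⟩
    simp only [Finset.mem_filter, Finset.mem_univ, true_and]
    have : hitCount S (Metric.closedBall (S i) (dist (S j) (S i))) = n := by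
      unfold hitCount
      rw [Finset.filter_true_of_mem (fun l _ => by simpa using hj l (Finset.mem_univ l))]
      simp
    omega
  obtain ⟨j, hj, hmin⟩ := Finset.exists_min_image _ (fun j => dist (S j) (S i)) hne
  simp only [Finset.mem_filter, Finset.mem_univ, true_and] at hj hmin
  set r := dist (S j) (S i) with hr
  -- The open ball contains the same points as the closed ball at the preceding sample radius, whose
  -- count is below b by minimality of r.
  have hopen : hitCount S (Metric.ball (S i) r) < b := by
    by_cases h : ∃ l, dist (S l) (S i) < r
    · obtain ⟨l0, hl0⟩ := h
      obtain ⟨l, hl, hmax⟩ := Finset.exists_max_image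
        (Finset.univ.filter fun l => dist (S l) (S i) < r) (fun l => dist (S l) (S i))
        ⟨l0, by simpa using hl0⟩
      simp only [Finset.mem_filter, Finset.mem_univ, true_and] at hl hmax
      have hlt : hitCount S (Metric.closedBall (S i) (dist (S l) (S i))) < b := by
        by_contra hc
        exact absurd (hmin l (not_lt.1 hc)) (not_le.2 hl)
      refine lt_of_eq_of_lt (hitCount_congr S fun a => ?_) hlt
      simp only [Metric.mem_closedBall, Metric.mem_ball]
      exact ⟨fun ha => hmax a ha, fun ha => ha.trans_lt hl⟩
    · push Not at h
      have : hitCount S (Metric.ball (S i) r) = 0 := by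
        unfold hitCount
        rw [Finset.filter_false_of_mem (fun l _ => by simpa using h l)]
        simp
      omega
  have hclosed := hitCount_closedBall_le_of_unique S (S i) j (hties j hopen)
  rw [← hr] at hclosed
  have hcount : ballCount S (S i) r = b := by
    rw [ballCount_eq_hitCount]
    omega
  -- At radius 0 the open ball is empty, so without ties the count is at most 1; this is excluded by
  -- b ≥ 2.
  have hrpos : 0 < r := by
    rcases (dist_nonneg : 0 ≤ dist (S j) (S i)).lt_or_eq with h | h
    · exact h
    · have : hitCount S (Metric.ball (S i) r) = 0 := by
        rw [hr, ← h, Metric.ball_zero]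
        simp [hitCount]
      omega
  have hbelow : ∀ s < r, ballCount S (S i) s < b := fun s hs =>
    (hitCount_mono S (Metric.closedBall_subset_ball hs)).trans_lt hopen
  have hleast : IsLeast {s : ℝ | 0 < s ∧ ballCount S (S i) s = b} r := by
    refine ⟨⟨hrpos, hcount⟩, fun s hs => ?_⟩
    by_contra hc
    exact absurd hs.2 (hbelow s (not_le.1 hc)).ne
  have : anchorRadius b S (S i) = r := hleast.csInf_eq
  rw [this]
  exact ⟨hrpos, hcount⟩

end Anchor

/-! ### Regularity and the accuracy of `est` -/

theorem IsRegularityConstant.mul_bounds {p : Measure (Euc d)} {k : ℕ} {ε c : ℝ} (hε : 0 < ε)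
    (hreg : IsRegularityConstant p k ε c) {x : Euc d} (hx : x ∈ p.support) {s r : ℝ} (hs : 0 < s)
    (hsr : s < r) (hr : p.real (Metric.closedBall x r) ≤ c) :
    (r / s) ^ k * p.real (Metric.closedBall x s) ≤ (1 + ε / 3) * p.real (Metric.closedBall x r) ∧
      p.real (Metric.closedBall x r) ≤
        (1 + ε / 3) * ((r / s) ^ k * p.real (Metric.closedBall x s)) := by
  obtain ⟨g1, g2⟩ := hreg.2.2 x hx s r hs hsr hr
  rw [← div_pow] at g1 g2
  have hr0 : 0 < r := hs.trans hsr
  set Pr := p.real (Metric.closedBall x r)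
  rcases (measureReal_nonneg (μ := p) (s := Metric.closedBall x s)).eq_or_lt with h | h
  · rw [← h, div_zero] at g1
    have : 0 < (1 + ε / 3)⁻¹ * (r / s) ^ k := by positivity
    linarith
  · rw [le_div_iff₀ h, mul_assoc, inv_mul_le_iff₀ (by positivity)] at g1
    rw [div_le_iff₀ h, mul_assoc] at g2
    exact ⟨g1, g2⟩

section Est

variable {n k b : ℕ} {S : Fin n → Euc d} {x : Euc d}

/-- Below the anchor radius the power law stays at most b/n, and from there on the count is at least
b, so the switch between the branches causes no drop. -/
theorem est_mono (ha : 0 < anchorRadius b S x) (hcount : ballCount S x (anchorRadius b S x) = b)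
    {r s : ℝ} (hr : 0 ≤ r) (hrs : r ≤ s) : est k b S x r ≤ est k b S x s := by
  have hn : (0 : ℝ) ≤ n := Nat.cast_nonneg n
  unfold est
  set a := anchorRadius b S x
  split_ifs with h1 h2 h2
  · gcongr
  · rw [mul_div_mul_comm]
    have h3 : r ^ k / a ^ k ≤ 1 := by
      rw [div_le_one (by positivity)]
      gcongr
    have h4 : (b : ℝ) ≤ ballCount S x s := by
      rw [← hcount]
      exact_mod_cast hitCount_mono S (Metric.closedBall_subset_closedBall (not_lt.1 h2))
    calc (b : ℝ) / n * (r ^ k / a ^ k) ≤ b / n * 1 := by gcongr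
      _ ≤ ballCount S x s / n := by rw [mul_one]; gcongr
  · exact absurd (hrs.trans_lt h2) h1
  · gcongr
    exact hitCount_mono S (Metric.closedBall_subset_closedBall hrs)

theorem est_zero (hk : 0 < k) (ha : 0 < anchorRadius b S x) : est k b S x 0 = 0 := by
  simp [est, ha, hk.ne']

/-- `Est` is a relative approximation of the mass of balls. -/
theorem est_approx {p : Measure (Euc d)} [IsProbabilityMeasure p] {ε c η : ℝ} (hn : 0 < n)
    (hk : 0 < k) (hε : 0 < ε) (hη : 0 ≤ η) (hη2 : η ≤ 1 / 2)
    (hreg : IsRegularityConstant p k ε c) (hx : x ∈ p.support)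
    (h0 : p.real (Metric.closedBall x 0) = 0)
    (hunif : ∀ r, |(ballCount S x r : ℝ) - n * p.real (Metric.closedBall x r)| ≤
      η * max (n * p.real (Metric.closedBall x r)) b)
    (ha : 0 < anchorRadius b S x) (hcount : ballCount S x (anchorRadius b S x) = b)
    (hc : 2 * (b : ℝ) ≤ n * c) {r : ℝ} (hr : 0 ≤ r) :
    (1 - η) * est k b S x r ≤ (1 + ε / 3) * p.real (Metric.closedBall x r) ∧
      (1 - η) * p.real (Metric.closedBall x r) ≤ (1 + ε / 3) * est k b S x r := by
  have hnR : (0 : ℝ) < n := by exact_mod_cast hn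
  have key : ∀ s, anchorRadius b S x ≤ s →
      (1 - η) * ((ballCount S x s : ℝ) / n) ≤ p.real (Metric.closedBall x s) ∧
      (1 - η) * p.real (Metric.closedBall x s) ≤ (ballCount S x s : ℝ) / n := by
    intro s hs
    have hbs : (b : ℝ) ≤ ballCount S x s := by
      rw [← hcount]
      exact_mod_cast hitCount_mono S (Metric.closedBall_subset_closedBall hs)
    have h := relative_of_le_count hη (by linarith) (Nat.cast_nonneg b) hbs (hunif s)
    constructor
    · rw [← mul_div_assoc, div_le_iff₀ hnR]
      linarith [h.1]
    · rw [le_div_iff₀ hnR]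
      linarith [h.2]
  rcases lt_or_ge r (anchorRadius b S x) with hra | hra
  · rcases hr.eq_or_lt with rfl | hr0
    · rw [est_zero hk ha, h0]
      simp
    · have hest : est k b S x r = b / n * (r ^ k / anchorRadius b S x ^ k) := by
        rw [est, if_pos hra, mul_div_mul_comm]
      rw [hest]
      obtain ⟨k1, k2⟩ := key _ le_rfl
      rw [hcount] at k1 k2
      set a := anchorRadius b S x
      set Pa := p.real (Metric.closedBall x a)
      set Pr := p.real (Metric.closedBall x r)
      -- The anchor ball is in the range of regularity: (1 - η)Pa ≤ b/n ≤ c/2, and η ≤ 1/2.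
      have hPa : Pa ≤ c := by
        rw [le_div_iff₀ hnR] at k2
        have h3 : 1 / 2 * (Pa * n) ≤ (1 - η) * (Pa * n) :=
          mul_le_mul_of_nonneg_right (by linarith) (by positivity)
        have : Pa * n ≤ c * n := by linarith
        exact le_of_mul_le_mul_right this hnR
      obtain ⟨g1, g2⟩ := hreg.mul_bounds hε hx hr0 hra hPa
      have hq : 0 < r ^ k / a ^ k := by positivity
      have hκ : 0 < 1 + ε / 3 := by positivity
      have e : (a / r) ^ k * (r ^ k / a ^ k) = 1 := by
        rw [div_pow, div_mul_div_cancel₀ (by positivity), div_self (by positivity)]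
      set ρ := r ^ k / a ^ k
      have g1' : Pr ≤ (1 + ε / 3) * (Pa * ρ) := by
        calc Pr = (a / r) ^ k * Pr * ρ := by rw [mul_right_comm, e, one_mul]
          _ ≤ (1 + ε / 3) * Pa * ρ := mul_le_mul_of_nonneg_right g1 hq.le
          _ = _ := by ring
      have g2' : Pa * ρ ≤ (1 + ε / 3) * Pr := by
        calc Pa * ρ ≤ (1 + ε / 3) * ((a / r) ^ k * Pr) * ρ := mul_le_mul_of_nonneg_right g2 hq.le
          _ = (1 + ε / 3) * Pr * ((a / r) ^ k * ρ) := by ring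
          _ = _ := by rw [e, mul_one]
      constructor
      · have := mul_le_mul_of_nonneg_right k1 hq.le
        linarith
      · have h3 := mul_le_mul_of_nonneg_right k2 hq.le
        have h4 := mul_le_mul_of_nonneg_left h3 hκ.le
        have h5 := mul_le_mul_of_nonneg_left g1' (show 0 ≤ 1 - η by linarith)
        linarith
  · have hest : est k b S x r = ballCount S x r / n := by rw [est, if_neg (not_lt.2 hra)]
    rw [hest]
    obtain ⟨k1, k2⟩ := key r hra
    have h1 : 0 ≤ p.real (Metric.closedBall x r) := measureReal_nonneg
    have h2 : (0 : ℝ) ≤ ballCount S x r / n := by positivity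
    constructor
    · nlinarith
    · nlinarith

end Est

/-! ### The region found by the search -/

/-- The union of the balls `B(x_i, r_i^*)`. -/
def detectRegion {n m : ℕ} (k b : ℕ) (lam gam : ℝ) (S : Fin n → Euc d) (T : Fin m → Euc d) :
    Set (Euc d) :=
  {x | ∃ i, ((‖x - S i‖ : ℝ) : WithBot ℝ) ≤ copyRadius k b lam gam S T i}

theorem detectOutput_eq {n m u : ℕ} (k b : ℕ) (lam gam : ℝ) (S : Fin n → Euc d)
    (T : Fin m → Euc d) (U : Fin u → Euc d) :
    detectOutput k b lam gam S T U = (hitCount U (detectRegion k b lam gam S T) : ℝ) / u := by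
  classical
  refine congrArg (fun s : Finset (Fin u) => (s.card : ℝ) / u) (Finset.ext fun j => ?_)
  rw [Finset.mem_filter, Finset.mem_filter]
  rfl

theorem mem_radii {m : ℕ} {T : Fin m → Euc d} {x : Euc d} {r : ℝ} :
    r ∈ radii T x ↔ r = 0 ∨ ∃ j, ‖T j - x‖ = r := by
  simp [radii]

/-- The radius `r` passes the test of the algorithm at `x`. -/
def IsAccepted {n m : ℕ} (k b : ℕ) (lam gam : ℝ) (S : Fin n → Euc d) (T : Fin m → Euc d)
    (x : Euc d) (r : ℝ) : Prop :=
  est k b S x r ≤ gam ∧ lam * est k b S x r ≤ (ballCount T x r : ℝ) / m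

theorem le_copyRadius {n m k b : ℕ} {lam gam : ℝ} {S : Fin n → Euc d} {T : Fin m → Euc d}
    {i : Fin n} {r : ℝ} (hr : r ∈ radii T (S i)) (h : IsAccepted k b lam gam S T (S i) r) :
    (r : WithBot ℝ) ≤ copyRadius k b lam gam S T i := by
  classical
  exact Finset.le_max (Finset.mem_filter.2 ⟨hr, h⟩)

theorem copyRadius_eq_bot_or {n m : ℕ} (k b : ℕ) (lam gam : ℝ) (S : Fin n → Euc d)
    (T : Fin m → Euc d) (i : Fin n) :
    copyRadius k b lam gam S T i = ⊥ ∨ ∃ r ∈ radii T (S i),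
      IsAccepted k b lam gam S T (S i) r ∧ copyRadius k b lam gam S T i = r := by
  classical
  rcases h : copyRadius k b lam gam S T i with _ | r
  · exact Or.inl rfl
  · have := Finset.mem_of_max h
    rw [Finset.mem_filter] at this
    exact Or.inr ⟨r, this.1, this.2, rfl⟩

/-- The largest accepted ball contains the others, so the maximum can be replaced by a finite union
of conditions, whose measurability is accessible. -/
theorem mem_detectRegion {n m k b : ℕ} {lam gam : ℝ} {S : Fin n → Euc d} {T : Fin m → Euc d}
    {x : Euc d} : x ∈ detectRegion k b lam gam S T ↔ ∃ i,
      (IsAccepted k b lam gam S T (S i) 0 ∧ ‖x - S i‖ ≤ 0) ∨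
      ∃ j, IsAccepted k b lam gam S T (S i) ‖T j - S i‖ ∧ ‖x - S i‖ ≤ ‖T j - S i‖ := by
  refine exists_congr fun i => ?_
  constructor
  · intro h
    rcases copyRadius_eq_bot_or k b lam gam S T i with h1 | ⟨r, hr, hacc, h1⟩
    · rw [h1] at h
      simp at h
    · rw [h1, WithBot.coe_le_coe] at h
      rcases mem_radii.1 hr with rfl | ⟨j, rfl⟩
      · exact Or.inl ⟨hacc, h⟩
      · exact Or.inr ⟨j, hacc, h⟩
  · rintro (⟨hacc, h⟩ | ⟨j, hacc, h⟩)
    · exact (WithBot.coe_le_coe.2 h).trans (le_copyRadius (mem_radii.2 (Or.inl rfl)) hacc)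
    · exact (WithBot.coe_le_coe.2 h).trans (le_copyRadius (mem_radii.2 (Or.inr ⟨j, rfl⟩)) hacc)

/-! ### Mass of the region against the copy rates -/

section Bounds

/-- The mass outside `W` of a union of concentric balls, over an arbitrary set of radii. -/
theorem measureReal_iUnion_closedBall_diff_le (q : Measure (Euc d)) [IsProbabilityMeasure q]
    (x : Euc d) (W : Set (Euc d)) (G : ℝ → Prop) {a : ℝ} (ha : 0 ≤ a)
    (h : ∀ r, G r → q.real (Metric.closedBall x r \ W) ≤ a) :
    q.real ({y | ∃ r, y ∈ Metric.closedBall x r ∧ G r} \ W) ≤ a := by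
  -- The lower closure of the radii gives the same union. It is order-connected, which makes
  -- continuity from below available for a monotone union over uncountably many radii.
  let L : Set ℝ := {r | ∃ r', G r' ∧ r ≤ r'}
  have hL : L.OrdConnected := ⟨fun r _ s hs z hz => by
    obtain ⟨r', hr', h'⟩ := hs
    exact ⟨r', hr', hz.2.trans h'⟩⟩
  have hset : ({y | ∃ r, y ∈ Metric.closedBall x r ∧ G r} \ W) =
      ⋃ r : L, Metric.closedBall x r \ W := by
    ext y
    simp only [Set.mem_sdiff, Set.mem_iUnion]
    constructor
    · rintro ⟨⟨r, hy, hr⟩, hW⟩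
      exact ⟨⟨r, r, hr, le_rfl⟩, hy, hW⟩
    · rintro ⟨⟨r, r', hr', hle⟩, hy, hW⟩
      exact ⟨⟨r', Metric.closedBall_subset_closedBall hle hy, hr'⟩, hW⟩
  have hmono : Monotone fun r : L => Metric.closedBall x (r : ℝ) \ W := fun r s hrs =>
    Set.sdiff_subset_sdiff_left (Metric.closedBall_subset_closedBall hrs)
  rw [hset, measureReal_def, hmono.measure_iUnion]
  refine ENNReal.toReal_le_of_le_ofReal ha (iSup_le fun r => ?_)
  obtain ⟨r, r', hr', hle⟩ := r
  refine (measure_mono (Set.sdiff_subset_sdiff_left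
    (Metric.closedBall_subset_closedBall hle))).trans ?_
  rw [← ofReal_measureReal]
  exact ENNReal.ofReal_le_ofReal (h r' hr')

/-- If the estimates are accurate, the region found by the algorithm has nearly the right mass. -/
theorem region_bounds {n m k b : ℕ} {lam gam ε η : ℝ} {S : Fin n → Euc d} {T : Fin m → Euc d}
    (p q : Measure (Euc d)) [IsProbabilityMeasure p] [IsProbabilityMeasure q]
    (hn : 0 < n) (hm : 0 < m) (hlam : 0 < lam) (hgam : 0 < gam) (hε : 0 < ε) (hε1 : ε ≤ 1)
    (hη : η = ε / 8)
    (hmono : ∀ i r s, 0 ≤ r → r ≤ s → est k b S (S i) r ≤ est k b S (S i) s)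
    (hzero : ∀ i, est k b S (S i) 0 = 0)
    (hest : ∀ i r, 0 ≤ r →
      (1 - η) * est k b S (S i) r ≤ (1 + ε / 3) * p.real (Metric.closedBall (S i) r) ∧
      (1 - η) * p.real (Metric.closedBall (S i) r) ≤ (1 + ε / 3) * est k b S (S i) r)
    (hq : ∀ i r, |(ballCount T (S i) r : ℝ) - m * q.real (Metric.closedBall (S i) r)| ≤
      η * (ε / (4 * n)) * m) :
    copyRateLower p S q lam gam ε - ε / 2 ≤ q.real (detectRegion k b lam gam S T) ∧
      q.real (detectRegion k b lam gam S T) ≤ copyRateUpper p S q lam gam ε + ε / 2 := by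
  have hnR : (0 : ℝ) < n := by exact_mod_cast hn
  have hmR : (0 : ℝ) < m := by exact_mod_cast hm
  set τ : ℝ := ε / (4 * n) with hτ
  have hτ0 : 0 < τ := by positivity
  have hη0 : 0 < η := by rw [hη]; positivity
  have hη8 : η ≤ 1 / 8 := by rw [hη]; linarith
  have hq1 : ∀ i r, (ballCount T (S i) r : ℝ) / m ≤ q.real (Metric.closedBall (S i) r) + η * τ := by
    intro i r
    rw [div_le_iff₀ hmR]
    linarith [(abs_le.1 (hq i r)).2]
  have hq2 : ∀ i r, q.real (Metric.closedBall (S i) r) - η * τ ≤ (ballCount T (S i) r : ℝ) / m := by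
    intro i r
    rw [le_div_iff₀ hmR]
    linarith [(abs_le.1 (hq i r)).1]
  set ρ := copyRadius k b lam gam S T with hρ
  let W : Fin n → Set (Euc d) := fun i => {x | ((‖x - S i‖ : ℝ) : WithBot ℝ) ≤ ρ i}
  have hW : detectRegion k b lam gam S T = ⋃ i, W i := by
    ext x
    simp [detectRegion, W, hρ]
  have hnτ : ∑ _i : Fin n, 2 * τ = ε / 2 := by
    rw [Finset.sum_const, Finset.card_univ, Fintype.card_fin, nsmul_eq_mul, hτ]
    field_simp
    norm_num
  rw [hW]
  constructor
  · have hG : ∀ i r, lam * (1 + ε) * p.real (Metric.closedBall (S i) r) ≤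
        q.real (Metric.closedBall (S i) r) ∧
        p.real (Metric.closedBall (S i) r) ≤ gam * (1 + ε)⁻¹ →
        q.real (Metric.closedBall (S i) r \ W i) ≤ 2 * τ := by
      rintro i r ⟨h1, h2⟩
      rcases lt_or_ge r 0 with hr | hr
      · rw [Metric.closedBall_eq_empty.2 hr]
        simp [hτ0.le]
      set P := p.real (Metric.closedBall (S i) r)
      set Q := q.real (Metric.closedBall (S i) r) with hQ
      have hP0 : 0 ≤ P := measureReal_nonneg
      -- Light balls are charged to the additive error. On the others ητ ≤ ηQ.
      rcases lt_or_ge Q τ with hQτ | hQτ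
      · exact (measureReal_mono Set.sdiff_subset).trans (by linarith)
      obtain ⟨e1, e2⟩ := hest i r hr
      set e := est k b S (S i) r with he
      have he0 : 0 ≤ e := by
        rw [← hzero i]
        exact hmono i 0 r le_rfl hr
      have hegam : e ≤ gam := by
        have h3 : P * (1 + ε) ≤ gam := by
          rwa [← div_eq_mul_inv, le_div_iff₀ (by positivity)] at h2
        -- The numerical fact is 1 + ε/3 ≤ (1 - ε/8)(1 + ε) for ε ≤ 1.
        have h4 : (1 + ε / 3) * P ≤ (1 - η) * (P * (1 + ε)) := by
          rw [show (1 - η) * (P * (1 + ε)) = ((1 - η) * (1 + ε)) * P by ring]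
          refine mul_le_mul_of_nonneg_right ?_ hP0
          rw [hη]
          nlinarith
        have h5 : (1 - η) * e ≤ (1 - η) * gam :=
          (e1.trans h4).trans (mul_le_mul_of_nonneg_left h3 (by linarith))
        exact le_of_mul_le_mul_left h5 (by linarith)
      have heT : lam * e ≤ Q - η * τ := by
        have h3 : (1 - η) * Q ≤ Q - η * τ := by
          have := mul_le_mul_of_nonneg_left hQτ hη0.le
          linarith
        -- Here a second factor 1 - η is spent on the error of T: 1 + ε/3 ≤ (1 - ε/8)²(1 + ε).
        have h4 : (1 - η) * e ≤ (1 - η) * ((1 - η) * ((1 + ε) * P)) := by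
          refine e1.trans ?_
          rw [show (1 - η) * ((1 - η) * ((1 + ε) * P)) = ((1 - η) * ((1 - η) * (1 + ε))) * P by ring]
          refine mul_le_mul_of_nonneg_right ?_ hP0
          rw [hη]
          nlinarith [mul_nonneg hε.le hε.le, mul_nonneg (mul_nonneg hε.le hε.le) hε.le]
        have h5 : e ≤ (1 - η) * ((1 + ε) * P) := le_of_mul_le_mul_left h4 (by linarith)
        calc lam * e ≤ lam * ((1 - η) * ((1 + ε) * P)) := by gcongr
          _ = (1 - η) * (lam * (1 + ε) * P) := by ring
          _ ≤ (1 - η) * Q := mul_le_mul_of_nonneg_left h1 (by linarith)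
          _ ≤ _ := h3
      -- Round r down to a candidate radius. The count of T is unchanged and `est` does not
      -- increase, so r' is accepted. The shell in between contains no point of T, hence its q-mass
      -- is at most 2ητ.
      obtain ⟨r', hr'mem, hr'max⟩ := Finset.exists_max_image
        ((radii T (S i)).filter fun s => s ≤ r) id
        ⟨0, by simp [mem_radii, hr]⟩
      simp only [Finset.mem_filter, id] at hr'mem hr'max
      have hr'0 : 0 ≤ r' := hr'max 0 ⟨mem_radii.2 (Or.inl rfl), hr⟩
      have hcount : ballCount T (S i) r = ballCount T (S i) r' := by
        refine hitCount_congr T fun j => ?_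
        simp only [Metric.mem_closedBall, dist_eq_norm]
        exact ⟨fun h => hr'max _ ⟨mem_radii.2 (Or.inr ⟨j, rfl⟩), h⟩, fun h => h.trans hr'mem.2⟩
      have hacc : IsAccepted k b lam gam S T (S i) r' := by
        have h3 := hmono i r' r hr'0 hr'mem.2
        refine ⟨h3.trans hegam, ?_⟩
        calc lam * est k b S (S i) r' ≤ lam * e := by gcongr
          _ ≤ _ := heT
          _ ≤ _ := hq2 i r
          _ = _ := by rw [hcount]
      have hsub : Metric.closedBall (S i) r' ⊆ W i := fun y hy => by
        refine (WithBot.coe_le_coe.2 ?_).trans (le_copyRadius hr'mem.1 hacc)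
        rwa [← dist_eq_norm]
      have h6 : q.real (Metric.closedBall (S i) r \ Metric.closedBall (S i) r') ≤ 2 * (η * τ) := by
        rw [measureReal_sdiff (Metric.closedBall_subset_closedBall hr'mem.2)
          measurableSet_closedBall]
        have h7 := hq1 i r'
        have h8 := hq2 i r
        rw [hcount] at h8
        linarith
      calc q.real (Metric.closedBall (S i) r \ W i) ≤
          q.real (Metric.closedBall (S i) r \ Metric.closedBall (S i) r') :=
            measureReal_mono (Set.sdiff_subset_sdiff_right hsub)
        _ ≤ 2 * (η * τ) := h6
        _ ≤ 2 * τ := by nlinarith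
    have hC : {x' | ∃ i, IsCopy p q (lam * (1 + ε)) (gam * (1 + ε)⁻¹) (S i) x'} ⊆
        (⋃ i, W i) ∪ ⋃ i, ({x' | IsCopy p q (lam * (1 + ε)) (gam * (1 + ε)⁻¹) (S i) x'} \ W i) := by
      rintro x ⟨i, hi⟩
      by_cases hx : x ∈ W i
      · exact Or.inl (Set.mem_iUnion.2 ⟨i, hx⟩)
      · exact Or.inr (Set.mem_iUnion.2 ⟨i, hi, hx⟩)
    have hsum := (measureReal_iUnion_fintype_le (μ := q) fun i =>
      ({x' | IsCopy p q (lam * (1 + ε)) (gam * (1 + ε)⁻¹) (S i) x'} \ W i)).trans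
      (Finset.sum_le_sum fun i _ => measureReal_iUnion_closedBall_diff_le q (S i) (W i) _
        (by positivity : 0 ≤ 2 * τ) (hG i))
    rw [hnτ] at hsum
    have h9 := (measureReal_mono (μ := q) hC).trans (measureReal_union_le _ _)
    unfold copyRateLower copyRate
    linarith
  -- A heavy accepted ball itself witnesses copying at the relaxed parameters.
  · have hi : ∀ i, q.real (W i) ≤ 2 * τ ∨
        W i ⊆ {x' | ∃ i, IsCopy p q (lam * (1 + ε)⁻¹) (gam * (1 + ε)) (S i) x'} := by
      intro i
      rcases copyRadius_eq_bot_or k b lam gam S T i with h1 | ⟨r, hr, hacc, h1⟩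
      · left
        have : W i = ∅ := by
          ext x
          simp [W, hρ, h1]
        rw [this]
        simp [hτ0.le]
      · have hWr : W i = Metric.closedBall (S i) r := by
          ext x
          simp only [W, hρ, h1, Metric.mem_closedBall, dist_eq_norm]
          exact WithBot.coe_le_coe
        have hr0 : 0 ≤ r := by
          rcases mem_radii.1 hr with rfl | ⟨j, rfl⟩
          · exact le_rfl
          · exact norm_nonneg _
        rw [hWr]
        set Q := q.real (Metric.closedBall (S i) r) with hQ
        rcases lt_or_ge Q τ with hQτ | hQτ
        · left; linarith
        right
        obtain ⟨e1, e2⟩ := hest i r hr0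
        obtain ⟨a1, a2⟩ := hacc
        have hqT := hq1 i r
        have he0 : 0 ≤ est k b S (S i) r := by
          rw [← hzero i]
          exact hmono i 0 r le_rfl hr0
        set e := est k b S (S i) r
        set P := p.real (Metric.closedBall (S i) r) with hP
        have hQ0 : 0 ≤ Q := measureReal_nonneg
        have hη1 : 0 < 1 - η := by linarith
        have b1 : P ≤ gam * (1 + ε) := by
          refine le_of_mul_le_mul_left (e2.trans ?_) hη1
          calc (1 + ε / 3) * e ≤ (1 + ε / 3) * gam := by gcongr
            _ ≤ ((1 - η) * (1 + ε)) * gam := by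
              refine mul_le_mul_of_nonneg_right ?_ hgam.le
              rw [hη]; nlinarith
            _ = _ := by ring
        have b2 : lam * (1 + ε)⁻¹ * P ≤ Q := by
          have h3 : lam * P ≤ (1 + ε) * Q := by
            refine le_of_mul_le_mul_left ?_ hη1
            calc (1 - η) * (lam * P) = lam * ((1 - η) * P) := by ring
              _ ≤ lam * ((1 + ε / 3) * e) := by gcongr
              _ = (1 + ε / 3) * (lam * e) := by ring
              _ ≤ (1 + ε / 3) * ((1 + η) * Q) := by
                refine mul_le_mul_of_nonneg_left ?_ (by positivity)
                have := mul_le_mul_of_nonneg_left hQτ hη0.le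
                linarith
              _ = ((1 + ε / 3) * (1 + η)) * Q := by ring
              _ ≤ ((1 - η) * (1 + ε)) * Q := by
                refine mul_le_mul_of_nonneg_right ?_ hQ0
                rw [hη]; nlinarith
              _ = _ := by ring
          rw [mul_right_comm, ← div_eq_mul_inv, div_le_iff₀ (by positivity)]
          linarith
        exact fun x hx => ⟨i, r, hx, b2, b1⟩
    have hsub : (⋃ i, W i) ⊆ {x' | ∃ i, IsCopy p q (lam * (1 + ε)⁻¹) (gam * (1 + ε)) (S i) x'} ∪
        ⋃ i, (W i \ {x' | ∃ i, IsCopy p q (lam * (1 + ε)⁻¹) (gam * (1 + ε)) (S i) x'}) := by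
      intro x hx
      obtain ⟨i, hxi⟩ := Set.mem_iUnion.1 hx
      by_cases hc : x ∈ {x' | ∃ i, IsCopy p q (lam * (1 + ε)⁻¹) (gam * (1 + ε)) (S i) x'}
      · exact Or.inl hc
      · exact Or.inr (Set.mem_iUnion.2 ⟨i, hxi, hc⟩)
    have hsum := (measureReal_iUnion_fintype_le (μ := q) fun i =>
      (W i \ {x' | ∃ i, IsCopy p q (lam * (1 + ε)⁻¹) (gam * (1 + ε)) (S i) x'})).trans
      (Finset.sum_le_sum (g := fun _ => 2 * τ) fun i _ => by
        rcases hi i with h | h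
        · exact (measureReal_mono Set.sdiff_subset).trans h
        · rw [Set.sdiff_eq_empty.2 h]
          simp [hτ0.le])
    rw [hnτ] at hsum
    have h9 := (measureReal_mono (μ := q) hsub).trans (measureReal_union_le _ _)
    unfold copyRateUpper copyRate
    linarith

end Bounds

/-! ### Joint measurability of the region -/

section Measurability

variable {Ω : Type*} [MeasurableSpace Ω]

theorem measurable_ballCount {N : ℕ} {Z : Ω → Fin N → Euc d} {x : Ω → Euc d} {r : Ω → ℝ}
    (hZ : Measurable Z) (hx : Measurable x) (hr : Measurable r) :
    Measurable fun ω => ballCount (Z ω) (x ω) (r ω) := by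
  have h : Measurable fun ω => (ballCount (Z ω) (x ω) (r ω) : ℝ) :=
    measurable_hitCount (V := {w : Ω × Euc d | dist w.2 (x w.1) ≤ r w.1})
      (measurableSet_le (measurable_snd.dist (hx.comp measurable_fst)) (hr.comp measurable_fst)) hZ
  refine measurable_to_countable' fun a => ?_
  have : (fun ω => ballCount (Z ω) (x ω) (r ω)) ⁻¹' {a} =
      (fun ω => (ballCount (Z ω) (x ω) (r ω) : ℝ)) ⁻¹' {(a : ℝ)} := by
    ext ω
    simp
  rw [this]
  exact h (measurableSet_singleton _)

/-- The count stays constant until the next sample radius, so real radii can be replaced by slightly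
larger rational ones. -/
theorem exists_rat_ballCount_eq {N : ℕ} (Z : Fin N → Euc d) (x : Euc d) {s a : ℝ} (hsa : s < a) :
    ∃ t : ℚ, s < t ∧ (t : ℝ) < a ∧ ballCount Z x t = ballCount Z x s := by
  classical
  have h : ∃ a' ≤ a, s < a' ∧ ∀ i, s < dist (Z i) x → a' ≤ dist (Z i) x := by
    by_cases hne : ∃ i, s < dist (Z i) x
    · obtain ⟨i0, hi0⟩ := hne
      obtain ⟨i, hi, hmin⟩ := Finset.exists_min_image
        (Finset.univ.filter fun i => s < dist (Z i) x) (fun i => dist (Z i) x)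
        ⟨i0, by simpa using hi0⟩
      simp only [Finset.mem_filter, Finset.mem_univ, true_and] at hi hmin
      exact ⟨min a (dist (Z i) x), min_le_left _ _, lt_min hsa hi,
        fun l hl => (min_le_right _ _).trans (hmin l hl)⟩
    · push Not at hne
      exact ⟨a, le_rfl, hsa, fun i hi => absurd hi (not_lt.2 (hne i))⟩
  obtain ⟨a', ha', hs, hall⟩ := h
  obtain ⟨t, ht1, ht2⟩ := exists_rat_btwn hs
  refine ⟨t, ht1, ht2.trans_le ha', hitCount_congr Z fun i => ?_⟩
  simp only [Metric.mem_closedBall]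
  constructor
  · intro h
    by_contra hc
    exact absurd (hall i (not_le.1 hc)) (not_le.2 (h.trans_lt ht2))
  · intro h
    exact h.trans ht1.le

theorem measurable_anchorRadius {N b : ℕ} {Z : Ω → Fin N → Euc d} {x : Ω → Euc d}
    (hZ : Measurable Z) (hx : Measurable x) :
    Measurable fun ω => anchorRadius b (Z ω) (x ω) := by
  have hmeas : ∀ t : ℚ, MeasurableSet {ω | ballCount (Z ω) (x ω) t = b} := fun t =>
    measurable_ballCount hZ hx measurable_const (measurableSet_singleton b)
  refine measurable_of_Iio fun a => ?_
  -- The second set accounts for `sInf ∅ = 0` when no radius has count b.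
  have : (fun ω => anchorRadius b (Z ω) (x ω)) ⁻¹' Set.Iio a =
      (⋃ t : ℚ, {ω | (0 < (t : ℝ) ∧ (t : ℝ) < a) ∧ ballCount (Z ω) (x ω) t = b}) ∪
      {ω | 0 < a ∧ ∀ t : ℚ, 0 < (t : ℝ) → ballCount (Z ω) (x ω) t ≠ b} := by
    ext ω
    simp only [Set.mem_preimage, Set.mem_Iio, Set.mem_union, Set.mem_iUnion]
    have hbdd : BddBelow {s : ℝ | 0 < s ∧ ballCount (Z ω) (x ω) s = b} := ⟨0, fun s hs => hs.1.le⟩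
    constructor
    · intro h
      by_cases hne : {s : ℝ | 0 < s ∧ ballCount (Z ω) (x ω) s = b}.Nonempty
      · left
        obtain ⟨s, hs, hsa⟩ := (csInf_lt_iff hbdd hne).1 h
        obtain ⟨t, ht1, ht2, ht3⟩ := exists_rat_ballCount_eq (Z ω) (x ω) hsa
        exact ⟨t, ⟨hs.1.trans ht1, ht2⟩, ht3.trans hs.2⟩
      · right
        rw [Set.not_nonempty_iff_eq_empty] at hne
        rw [anchorRadius, hne, Real.sInf_empty] at h
        refine ⟨h, fun t ht hc => ?_⟩
        have : (t : ℝ) ∈ {s : ℝ | 0 < s ∧ ballCount (Z ω) (x ω) s = b} := ⟨ht, hc⟩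
        rw [hne] at this
        exact this
    · rintro (⟨t, ⟨ht0, hta⟩, ht⟩ | ⟨ha, hall⟩)
      · exact (csInf_le hbdd ⟨ht0, ht⟩).trans_lt hta
      · have : {s : ℝ | 0 < s ∧ ballCount (Z ω) (x ω) s = b} = ∅ := by
          ext s
          constructor
          · rintro ⟨hs, hsb⟩
            obtain ⟨t, ht1, ht2, ht3⟩ := exists_rat_ballCount_eq (Z ω) (x ω) (lt_add_one s)
            exact hall t (hs.trans ht1) (ht3.trans hsb)
          · exact fun h => h.elim
        rw [anchorRadius, this, Real.sInf_empty]
        exact ha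
  have hall : MeasurableSet {ω | ∀ t : ℚ, 0 < (t : ℝ) → ballCount (Z ω) (x ω) t ≠ b} := by
    simp only [Set.ofPred_forall]
    refine MeasurableSet.iInter fun t => ?_
    by_cases ht : 0 < (t : ℝ)
    · simp only [ht, Set.iInter_true]
      exact (hmeas t).compl
    · simp [ht]
  rw [this]
  exact (MeasurableSet.iUnion fun t => (MeasurableSet.const _).inter (hmeas t)).union
    ((MeasurableSet.const _).inter hall)

theorem measurable_est {N k b : ℕ} {Z : Ω → Fin N → Euc d} {x : Ω → Euc d} {r : Ω → ℝ}
    (hZ : Measurable Z) (hx : Measurable x) (hr : Measurable r) :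
    Measurable fun ω => est k b (Z ω) (x ω) (r ω) := by
  have ha := measurable_anchorRadius (b := b) hZ hx
  have hc : Measurable fun ω => (ballCount (Z ω) (x ω) (r ω) : ℝ) :=
    measurable_from_top.comp (measurable_ballCount hZ hx hr)
  unfold est
  exact Measurable.ite (measurableSet_lt hr ha)
    (((hr.pow_const k).const_mul _).div ((ha.pow_const k).const_mul _)) (hc.div_const _)

theorem measurableSet_isAccepted {n m k b : ℕ} {lam gam : ℝ} {S : Ω → Fin n → Euc d}
    {T : Ω → Fin m → Euc d} {x : Ω → Euc d} {r : Ω → ℝ}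
    (hS : Measurable S) (hT : Measurable T) (hx : Measurable x) (hr : Measurable r) :
    MeasurableSet {ω | IsAccepted k b lam gam (S ω) (T ω) (x ω) (r ω)} := by
  have he := measurable_est (k := k) (b := b) hS hx hr
  have hc : Measurable fun ω => (ballCount (T ω) (x ω) (r ω) : ℝ) :=
    measurable_from_top.comp (measurable_ballCount hT hx hr)
  exact (measurableSet_le he measurable_const).inter
    (measurableSet_le (he.const_mul lam) (hc.div_const _))

/-- Measurability jointly in the sample and the tested point is what allows Fubini to treat the test
sample with the region held fixed. -/
theorem measurableSet_detectRegion {n m k b : ℕ} {lam gam : ℝ} {S : Ω → Fin n → Euc d}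
    {T : Ω → Fin m → Euc d} (hS : Measurable S) (hT : Measurable T) :
    MeasurableSet {w : Ω × Euc d | w.2 ∈ detectRegion k b lam gam (S w.1) (T w.1)} := by
  have hS' : Measurable fun w : Ω × Euc d => S w.1 := hS.comp measurable_fst
  have hT' : Measurable fun w : Ω × Euc d => T w.1 := hT.comp measurable_fst
  have hSi : ∀ i, Measurable fun w : Ω × Euc d => S w.1 i := fun i =>
    (measurable_pi_apply i).comp hS'
  have hTj : ∀ j, Measurable fun w : Ω × Euc d => T w.1 j := fun j =>
    (measurable_pi_apply j).comp hT'
  have hset : {w : Ω × Euc d | w.2 ∈ detectRegion k b lam gam (S w.1) (T w.1)} =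
      ⋃ i, (({w | IsAccepted k b lam gam (S w.1) (T w.1) (S w.1 i) 0} ∩
        {w | ‖w.2 - S w.1 i‖ ≤ 0}) ∪
      ⋃ j, ({w | IsAccepted k b lam gam (S w.1) (T w.1) (S w.1 i) ‖T w.1 j - S w.1 i‖} ∩
        {w | ‖w.2 - S w.1 i‖ ≤ ‖T w.1 j - S w.1 i‖})) := by
    ext w
    simp only [Set.mem_ofPred_eq, mem_detectRegion, Set.mem_iUnion, Set.mem_union, Set.mem_inter_iff]
  rw [hset]
  refine MeasurableSet.iUnion fun i => MeasurableSet.union ?_ (MeasurableSet.iUnion fun j => ?_)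
  · exact (measurableSet_isAccepted hS' hT' (hSi i) measurable_const).inter
      (measurableSet_le (measurable_snd.sub (hSi i)).norm measurable_const)
  · exact (measurableSet_isAccepted hS' hT' (hSi i) ((hTj j).sub (hSi i)).norm).inter
      (measurableSet_le (measurable_snd.sub (hSi i)).norm ((hTj j).sub (hSi i)).norm)

end Measurability

/-- An atom cannot lie in the exceptional null set, so the condition holds at it; the sphere of
radius 0 then contradicts its positive mass. -/
theorem measure_singleton_eq_zero {p : Measure (Euc d)} {c : ℝ} (hc : 0 < c)
    (hnull : HasNullSpheresBelow p c) (x : Euc d) : p {x} = 0 := by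
  by_contra h
  have hx : ∀ r : ℝ, 0 ≤ r → p.real (Metric.ball x r) < c → p (Metric.sphere x r) = 0 := by
    by_contra hx
    exact h (measure_mono_null (Set.singleton_subset_iff.2 hx) (ae_iff.1 hnull))
  refine h ?_
  have := hx 0 le_rfl (by simpa using hc)
  rwa [Metric.sphere_zero] at this

/-! ### Dimension one is vacuous -/

section DimensionOne

theorem dist_euc_one (x y : Euc 1) : dist x y = |x 0 - y 0| := by
  simp [EuclideanSpace.dist_eq, Real.sqrt_sq_eq_abs, Real.dist_eq]

theorem continuous_cdf (μ : Measure ℝ) [IsProbabilityMeasure μ] [NullSingletonClass μ] :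
    Continuous (cdf μ) := by
  refine continuous_iff_continuousAt.2 fun x => ?_
  rw [(cdf μ).mono.continuousAt_iff_leftLim_eq_rightLim, StieltjesFunction.rightLim_eq]
  have h := (cdf μ).measure_singleton x
  rw [measure_cdf, measure_singleton] at h
  have h1 := ENNReal.ofReal_eq_zero.1 h.symm
  exact le_antisymm ((cdf μ).mono.leftLim_le le_rfl) (by linarith)

/-- There are no atomless regular distributions on the line: near the lower end of the support,
balls grow at the wrong rate. -/
theorem not_isRegularityConstant_dim_one (p : Measure (Euc 1)) [IsProbabilityMeasure p] {k : ℕ}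
    (hk : 0 < k) {ε c : ℝ} (hε : 0 < ε) (hε1 : ε ≤ 1) (hnull : HasNullSpheresBelow p c) :
    ¬ IsRegularityConstant p k ε c := by
  -- Take a support point x with almost no mass to its left, and y = x + t in the support with t
  -- small against R. Then B(y, t) has nearly all the mass of B(x, 2t), so regularity at y gives
  -- B(y, R - t) about (2(R - t)/R)^k times the mass of B(x, R), up to constants near 1. But B(y, R
  -- - t) lies in B(x, R).
  intro hreg
  have hc0 : 0 < c := hreg.1
  have hc1 : c ≤ 1 := hreg.2.1
  have hf : Measurable fun y : Euc 1 => y 0 := by fun_prop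
  set μ : Measure ℝ := p.map fun y => y 0 with hμ
  have : IsProbabilityMeasure μ := Measure.isProbabilityMeasure_map hf.aemeasurable
  have : NullSingletonClass μ := ⟨fun a => by
    rw [hμ, Measure.map_apply hf (measurableSet_singleton a)]
    have : (fun y : Euc 1 => y 0) ⁻¹' {a} = {WithLp.toLp 2 fun _ => a} := by
      ext y
      simp only [Set.mem_preimage, Set.mem_singleton_iff]
      constructor
      · intro h
        ext i
        rw [Subsingleton.elim i 0, h]
      · rintro rfl
        rfl
    rw [this]
    exact measure_singleton_eq_zero hc0 hnull _⟩
  set F := cdf μ with hF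
  have hFc : Continuous F := continuous_cdf μ
  have hFm : Monotone F := (cdf μ).mono
  have hF0 : ∀ z, 0 ≤ F z := cdf_nonneg μ
  have hIoc : ∀ a b : ℝ, p.real ((fun y : Euc 1 => y 0) ⁻¹' Set.Ioc a b) = max (F b - F a) 0 := by
    intro a b
    rw [measureReal_def, ← Measure.map_apply hf measurableSet_Ioc, ← hμ, ← measure_cdf μ,
      StieltjesFunction.measure_Ioc, ENNReal.toReal_ofReal']
  have hball : ∀ x : Euc 1, ∀ r : ℝ, 0 ≤ r →
      p.real (Metric.closedBall x r) = F (x 0 + r) - F (x 0 - r) := by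
    intro x r hr
    have : Metric.closedBall x r = (fun y : Euc 1 => y 0) ⁻¹' Set.Icc (x 0 - r) (x 0 + r) := by
      ext y
      rw [Metric.mem_closedBall, dist_euc_one, abs_le, Set.mem_preimage, Set.mem_Icc]
      constructor <;> rintro ⟨h1, h2⟩ <;> constructor <;> linarith
    rw [this, measureReal_def, ← Measure.map_apply hf measurableSet_Icc, ← hμ, ← Ioc_ae_eq_Icc.measure_eq,
      ← measure_cdf μ, StieltjesFunction.measure_Ioc, ENNReal.toReal_ofReal]
    exact sub_nonneg.2 (hFm (by linarith))
  -- Halving keeps c' below 1, so that some ball has mass exactly c'. The size of α makes the loss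
  -- 40^k α equal to c'/20.
  set c' := c / 2 with hc'
  have hc'0 : 0 < c' := by positivity
  set α := c' / (20 * 40 ^ k) with hα
  have hα0 : 0 < α := by positivity
  have hα40 : α * 40 ^ k = c' / 20 := by
    rw [hα]
    field_simp
  have hα20 : α * (20 * 20 ^ k) ≤ c' := by
    have h : (20 : ℝ) ^ k ≤ 40 ^ k := pow_le_pow_left₀ (by norm_num) (by norm_num) k
    calc α * (20 * 20 ^ k) ≤ α * (20 * 40 ^ k) := by gcongr
      _ = c' := by linarith
  have hα1 : α < 1 := by
    have : (1 : ℝ) ≤ 20 ^ k := one_le_pow₀ (by norm_num)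
    nlinarith
  obtain ⟨z, hz⟩ : ∃ z, F z = α := by
    obtain ⟨a, ha⟩ := ((tendsto_cdf_atBot μ).eventually (gt_mem_nhds hα0)).exists
    obtain ⟨b, hb⟩ := ((tendsto_cdf_atTop μ).eventually (lt_mem_nhds hα1)).exists
    exact mem_range_of_exists_le_of_exists_ge hFc ⟨a, ha.le⟩ ⟨b, hb.le⟩
  obtain ⟨x, hxz, hx⟩ : ((fun y : Euc 1 => y 0) ⁻¹' Set.Iic z ∩ p.support).Nonempty := by
    refine Measure.nonempty_inter_support_of_pos ?_
    rw [← Measure.map_apply hf measurableSet_Iic, ← hμ, ← ofReal_cdf, ENNReal.ofReal_pos, ← hF, hz]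
    exact hα0
  have hFx : F (x 0) ≤ α := hz ▸ hFm hxz
  obtain ⟨R, hR0, hR⟩ : ∃ R : ℝ, 0 < R ∧ p.real (Metric.closedBall x R) = c' := by
    have h1 : Filter.Tendsto (fun r => F (x 0 + r) - F (x 0 - r)) Filter.atTop (nhds (1 - 0)) :=
      ((tendsto_cdf_atTop μ).comp (Filter.tendsto_atTop_add_const_left _ _ Filter.tendsto_id)).sub
        ((tendsto_cdf_atBot μ).comp (Filter.tendsto_atBot_add_const_left _ _
          Filter.tendsto_neg_atTop_atBot))
    obtain ⟨b, hb, hb0⟩ := ((h1.eventually (lt_mem_nhds (show c' < 1 - 0 by linarith))).and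
      (Filter.eventually_ge_atTop 0)).exists
    have hcont : Continuous fun r => F (x 0 + r) - F (x 0 - r) := by fun_prop
    obtain ⟨R, hR, hRc⟩ := intermediate_value_Icc hb0 hcont.continuousOn
      (show c' ∈ Set.Icc _ _ from ⟨by simpa using hc'0.le, hb.le⟩)
    have hRc' : F (x 0 + R) - F (x 0 - R) = c' := hRc
    refine ⟨R, lt_of_le_of_ne hR.1 ?_, by rw [hball x R hR.1, hRc']⟩
    rintro rfl
    simp at hRc'
    linarith
  have hκ : 1 + ε / 3 ≤ 4 / 3 := by linarith
  have lower : ∀ s, 0 < s → s < R → 3 / 4 * c' * (s / R) ^ k ≤ p.real (Metric.closedBall x s) := by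
    intro s hs hsR
    have h := (hreg.mul_bounds hε hx hs hsR (by rw [hR]; linarith)).2
    rw [hR] at h
    have e : (R / s) ^ k * (s / R) ^ k = 1 := by
      rw [← mul_pow, div_mul_div_cancel₀ hs.ne', div_self hR0.ne', one_pow]
    have h' : c' ≤ 4 / 3 * ((R / s) ^ k * p.real (Metric.closedBall x s)) :=
      h.trans (by gcongr)
    have h'' := mul_le_mul_of_nonneg_right h' (by positivity : 0 ≤ (s / R) ^ k)
    have e2 : 4 / 3 * ((R / s) ^ k * p.real (Metric.closedBall x s)) * (s / R) ^ k =
        4 / 3 * p.real (Metric.closedBall x s) * ((R / s) ^ k * (s / R) ^ k) := by ring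
    rw [e2, e] at h''
    linarith
  -- This annulus has mass above α while its left half has at most α, so the right half meets the
  -- support. This provides y.
  have h20 : p.real (Metric.closedBall x (R / 40)) + α <
      p.real (Metric.closedBall x (R / 20)) := by
    have h1 := lower (R / 20) (by positivity) (by linarith)
    have h2 := (hreg.mul_bounds hε hx (s := R / 40) (by positivity) (show R / 40 < R by linarith)
      (by rw [hR]; linarith)).1
    have e1 : R / 20 / R = 1 / 20 := by field_simp
    have e2 : R / (R / 40) = 40 := by field_simp
    rw [hR, e2] at h2
    rw [e1] at h1
    set A := p.real (Metric.closedBall x (R / 40))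
    have h3 : (40 : ℝ) ^ k * A ≤ 4 / 3 * c' := h2.trans (by gcongr)
    have h4 : 2 * (20 : ℝ) ^ k ≤ 40 ^ k := by
      have : (40 : ℝ) ^ k = 2 ^ k * 20 ^ k := by rw [← mul_pow]; norm_num
      rw [this]
      have : (2 : ℝ) ≤ 2 ^ k := by
        calc (2 : ℝ) = 2 ^ 1 := by norm_num
          _ ≤ 2 ^ k := pow_le_pow_right₀ (by norm_num) hk
      gcongr
    have hA0 : 0 ≤ A := measureReal_nonneg
    have h5 : 20 ^ k * A ≤ 2 / 3 * c' := by
      have := mul_le_mul_of_nonneg_right h4 hA0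
      linarith
    refine lt_of_lt_of_le ?_ h1
    rw [div_pow, one_pow, ← mul_div_assoc, mul_one, lt_div_iff₀ (by positivity)]
    linarith
  rw [hball x _ (by positivity), hball x _ (by positivity)] at h20
  have hm1 : F (x 0 - R / 20) ≤ F (x 0) := hFm (by linarith)
  have hm2 := hF0 (x 0 - R / 20)
  obtain ⟨y, hyz, hy⟩ : ((fun y : Euc 1 => y 0) ⁻¹' Set.Ioc (x 0 + R / 40) (x 0 + R / 20) ∩
      p.support).Nonempty := by
    refine Measure.nonempty_inter_support_of_pos ?_
    have h : 0 < p.real ((fun y : Euc 1 => y 0) ⁻¹' Set.Ioc (x 0 + R / 40) (x 0 + R / 20)) := by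
      rw [hIoc]
      refine lt_max_of_lt_left ?_
      have : F (x 0 - R / 40) ≤ F (x 0) := hFm (by linarith)
      linarith
    exact (ENNReal.toReal_pos_iff.1 h).1
  obtain ⟨hy1, hy2⟩ := hyz
  simp only at hy1 hy2
  set t := y 0 - x 0 with ht
  have ht0 : 0 < t := by linarith
  have b1 : p.real (Metric.closedBall y (R - t)) ≤ c' := by
    rw [← hR, hball y _ (by linarith), hball x _ hR0.le]
    have e : y 0 + (R - t) = x 0 + R := by rw [ht]; ring
    rw [e]
    have : F (x 0 - R) ≤ F (y 0 - (R - t)) := hFm (by linarith)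
    linarith
  have b2 : 3 / 4 * c' * (2 * t / R) ^ k - α ≤ p.real (Metric.closedBall y t) := by
    have h := lower (2 * t) (by linarith) (by linarith)
    rw [hball x _ (by linarith)] at h
    rw [hball y _ ht0.le]
    have e1 : y 0 + t = x 0 + 2 * t := by rw [ht]; ring
    have e2 : y 0 - t = x 0 := by rw [ht]; ring
    rw [e1, e2]
    have := hF0 (x 0 - 2 * t)
    linarith
  have b3 := (hreg.mul_bounds hε hy ht0 (show t < R - t by linarith) (b1.trans (by linarith))).1
  have b4 : ((R - t) / t) ^ k * p.real (Metric.closedBall y t) ≤ 4 / 3 * c' :=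
    b3.trans (by gcongr)
  have b5 : ((R - t) / t) ^ k * (3 / 4 * c' * (2 * t / R) ^ k - α) ≤ 4 / 3 * c' :=
    (mul_le_mul_of_nonneg_left b2 (by
      have : 0 ≤ R - t := by linarith
      positivity)).trans b4
  have b6 : ((R - t) / t) ^ k ≤ 40 ^ k := by
    refine pow_le_pow_left₀ (div_nonneg (by linarith) ht0.le) ?_ k
    rw [div_le_iff₀ ht0]
    linarith
  have b7 : 19 / 10 ≤ ((R - t) / t) ^ k * (2 * t / R) ^ k := by
    rw [← mul_pow]
    have e : (R - t) / t * (2 * t / R) = 2 * (R - t) / R := by field_simp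
    have h : 19 / 10 ≤ 2 * (R - t) / R := by
      rw [le_div_iff₀ hR0]
      linarith
    rw [e]
    calc (19 / 10 : ℝ) = (19 / 10) ^ 1 := by norm_num
      _ ≤ (19 / 10) ^ k := pow_le_pow_right₀ (by norm_num) hk
      _ ≤ _ := pow_le_pow_left₀ (by norm_num) h k
  have b8 := mul_le_mul_of_nonneg_left b7 (by positivity : 0 ≤ 3 / 4 * c')
  have b9 := mul_le_mul_of_nonneg_left b6 hα0.le
  -- The contradiction is 19/10 · 3/4 - 1/20 > 4/3, in units of c'.
  linarith

end DimensionOne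

/-! ### Choice of b, m, u and of the sample size -/

section Parameters

variable {d n : ℕ} {ε δ c : ℝ}

/-- Solves the implicit condition on n, since b itself contains ln n. In terms of Y = ncε²/d one has
ln(n/δ) ≤ ln Y + 2Λ, and Y ≥ 2^20 Λ absorbs both terms. The assumption d ≥ 2 enters through Λ ≥ 1/2.
-/
theorem log_parameter_bounds (hd : 2 ≤ d) (hε : 0 < ε) (hε1 : ε ≤ 1) (hδ : 0 < δ) (hδ1 : δ ≤ 1)
    (hc : 0 < c) (hc1 : c ≤ 1)
    (hn : 2 ^ 20 * (d * Real.log (d / (δ * ε * c)) / (ε ^ 2 * c)) ≤ n) :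
    2 ^ 19 ≤ (n : ℝ) ∧ 2 * (4096 * (d * Real.log (n / δ) / ε ^ 2) + 1) ≤ n * c := by
  have hdR : (2 : ℝ) ≤ d := by exact_mod_cast hd
  have hd0 : (0 : ℝ) < d := by linarith
  have hδε : δ * ε ≤ 1 := mul_le_one₀ hδ1 hε.le hε1
  have hq : δ * ε * c ≤ 1 := mul_le_one₀ hδε hc.le hc1
  set Λ := Real.log (d / (δ * ε * c)) with hΛ
  have hlog2 : 1 / 2 ≤ Real.log 2 := by linarith [Real.log_two_gt_d9]
  have hΛ2 : 1 / 2 ≤ Λ := by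
    refine hlog2.trans (Real.log_le_log (by norm_num) ?_)
    rw [le_div_iff₀ (by positivity)]
    nlinarith
  set Y := n * c * ε ^ 2 / d with hY
  have hYΛ : 2 ^ 20 * Λ ≤ Y := by
    rw [hY, le_div_iff₀ hd0]
    rw [← mul_div_assoc, div_le_iff₀ (by positivity)] at hn
    linarith
  have hY19 : 2 ^ 19 ≤ Y := by linarith
  have hY0 : 0 < Y := by linarith
  have hε2 : ε ^ 2 ≤ 1 := pow_le_one₀ hε.le hε1
  have hYn : Y ≤ n := by
    rw [hY, div_le_iff₀ hd0]
    have h1 : c * ε ^ 2 ≤ 1 := mul_le_one₀ hc1 (by positivity) hε2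
    have h2 : (0 : ℝ) ≤ n := Nat.cast_nonneg n
    nlinarith
  have hn0 : (0 : ℝ) < n := by linarith
  refine ⟨hY19.trans hYn, ?_⟩
  have hdec : (n : ℝ) / δ = Y * (d / (δ * ε ^ 2 * c)) := by
    rw [hY]
    field_simp
  have hsq : (d : ℝ) / (δ * ε ^ 2 * c) ≤ (d / (δ * ε * c)) ^ 2 := by
    rw [div_pow, div_le_div_iff₀ (by positivity) (by positivity)]
    have e : (d : ℝ) ^ 2 * (δ * ε ^ 2 * c) = d * (δ * ε ^ 2 * c) * d := by ring
    have e' : d * (δ * ε * c) ^ 2 = d * (δ * ε ^ 2 * c) * (δ * c) := by ring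
    rw [e, e']
    refine mul_le_mul_of_nonneg_left ?_ (by positivity)
    have : δ * c ≤ 1 := mul_le_one₀ hδ1 hc.le hc1
    linarith
  have hℓ : Real.log (n / δ) ≤ Real.log Y + 2 * Λ := by
    rw [hdec, Real.log_mul hY0.ne' (by positivity)]
    have := Real.log_le_log (by positivity) hsq
    rw [Real.log_pow] at this
    push_cast at this
    linarith
  -- Tangent line of the logarithm at 2^15; its slope times 8192 is 1/4, leaving room in `hfin`.
  have hlogY : Real.log Y ≤ Y / 2 ^ 15 + 15 * Real.log 2 := by
    have h := Real.log_le_sub_one_of_pos (show 0 < Y / 2 ^ 15 by positivity)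
    rw [Real.log_div hY0.ne' (by positivity), Real.log_pow] at h
    push_cast at h
    linarith
  have hlog2' := Real.log_two_lt_d9
  have hfin : 8192 * Real.log (n / δ) + 2 ≤ Y := by linarith
  have h3 : n * c = Y * d / ε ^ 2 := by
    rw [hY]
    field_simp
  have h4 : 2 * (4096 * (d * Real.log (n / δ) / ε ^ 2) + 1) =
      (8192 * Real.log (n / δ) * d + 2 * ε ^ 2) / ε ^ 2 := by
    field_simp
    ring
  rw [h3, h4]
  refine div_le_div_of_nonneg_right ?_ (by positivity)
  nlinarith

theorem exp_neg_log_bound {x L : ℝ} (hx : 0 < x) (hL : Real.log x ≤ L) :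
    Real.exp (-(4 * L)) ≤ x⁻¹ ^ 4 := by
  have : x⁻¹ ^ 4 = Real.exp (-(4 * Real.log x)) := by
    rw [← Real.exp_log (inv_pos.2 hx), ← Real.exp_nat_mul, Real.log_inv]
    congr 1
    push_cast
    ring
  rw [this, Real.exp_le_exp]
  linarith

theorem one_le_log_of_large {n : ℝ} (hn : 2 ^ 19 ≤ n) : 1 ≤ Real.log n := by
  have h := Real.log_le_log (by norm_num) hn
  rw [Real.log_pow] at h
  push_cast at h
  linarith [Real.log_two_gt_d9]

/-- The exponent is ε²b/1024, and 4096 = 4 · 1024 makes each failure probability at most (δ/n)^4,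
against 2n² events. -/
theorem anchorCount_bounds (hd : 0 < d) (hε : 0 < ε) (hε1 : ε ≤ 1) (hδ : 0 < δ) (hδ1 : δ ≤ 1)
    (hn : 2 ^ 19 ≤ (n : ℝ)) :
    2 ≤ anchorCount 4096 d ε δ n ∧ 4 ≤ ε / 8 * (anchorCount 4096 d ε δ n : ℝ) ∧
      2 * n * n * Real.exp (-((ε / 8) ^ 2 * (anchorCount 4096 d ε δ n : ℝ) / 16)) ≤ δ / 3 := by
  have hdR : (1 : ℝ) ≤ d := by exact_mod_cast hd
  have hn0 : (0 : ℝ) < n := by linarith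
  set ℓ := Real.log (n / δ) with hℓ
  have hℓ1 : 1 ≤ ℓ := (one_le_log_of_large hn).trans
    (Real.log_le_log hn0 ((le_div_iff₀ hδ).2 (by nlinarith)))
  have hb : 4096 * (d * ℓ / ε ^ 2) ≤ (anchorCount 4096 d ε δ n : ℝ) := Nat.le_ceil _
  set b := (anchorCount 4096 d ε δ n : ℝ) with hbdef
  have hεb : 4096 * ℓ ≤ ε ^ 2 * b := by
    rw [← mul_div_assoc, div_le_iff₀ (by positivity)] at hb
    nlinarith
  have hb0 : 0 ≤ b := Nat.cast_nonneg _
  have h1 : ε ^ 2 * b ≤ ε * b := mul_le_mul_of_nonneg_right (by nlinarith) hb0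
  have h2 : ε * b ≤ b := mul_le_of_le_one_left hb0 hε1
  refine ⟨?_, by linarith, ?_⟩
  · have : (2 : ℝ) ≤ (anchorCount 4096 d ε δ n : ℝ) := by linarith
    exact_mod_cast this
  · have he : Real.exp (-((ε / 8) ^ 2 * b / 16)) ≤ (n / δ : ℝ)⁻¹ ^ 4 := by
      refine le_trans (Real.exp_le_exp.2 ?_) (exp_neg_log_bound (by positivity) le_rfl)
      have : (ε / 8) ^ 2 * b / 16 = ε ^ 2 * b / 1024 := by ring
      rw [this]
      linarith
    calc 2 * n * n * Real.exp (-((ε / 8) ^ 2 * b / 16)) ≤ 2 * n * n * (n / δ : ℝ)⁻¹ ^ 4 := by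
          gcongr
      _ = 2 * δ ^ 3 / n ^ 2 * δ := by field_simp
      _ ≤ 1 / 3 * δ := by
        refine mul_le_mul_of_nonneg_right ?_ hδ.le
        rw [div_le_iff₀ (by positivity)]
        have : δ ^ 3 ≤ 1 := pow_le_one₀ hδ.le hδ1
        nlinarith
      _ = δ / 3 := by ring

/-- The union bound has 2nm terms, with m inside the exponential as well. Half of the exponent ma
absorbs the factor m; the other half is at least 4ℓ, as 2^17 = 8 · 16384. -/
theorem searchSize_bounds (hd : 0 < d) (hε : 0 < ε) (hε1 : ε ≤ 1) (hδ : 0 < δ) (hδ1 : δ ≤ 1)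
    (hn : 2 ^ 19 ≤ (n : ℝ)) :
    0 < searchSize (2 ^ 17) d ε δ n ∧
      4 ≤ ε / 8 * (ε / (4 * n)) * (searchSize (2 ^ 17) d ε δ n : ℝ) ∧
      2 * n * (searchSize (2 ^ 17) d ε δ n : ℝ) * Real.exp (-((ε / 8 * (ε / (4 * n))) ^ 2 *
        (searchSize (2 ^ 17) d ε δ n : ℝ) / 16)) ≤ δ / 3 := by
  have hdR : (1 : ℝ) ≤ d := by exact_mod_cast hd
  have hn0 : (0 : ℝ) < n := by linarith
  have hδε : δ * ε ≤ 1 := mul_le_one₀ hδ1 hε.le hε1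
  set ℓ := Real.log (n * d / (δ * ε)) with hℓ
  have hℓ' : Real.log (n / (δ * ε)) ≤ ℓ := by
    refine Real.log_le_log (by positivity) ?_
    gcongr
    nlinarith
  have hℓ1 : 1 ≤ ℓ := ((one_le_log_of_large hn).trans
    (Real.log_le_log hn0 ((le_div_iff₀ (by positivity)).2 (by nlinarith)))).trans hℓ'
  have hm : 2 ^ 17 * (d * n ^ 2 * ℓ / ε ^ 4) ≤ (searchSize (2 ^ 17) d ε δ n : ℝ) := Nat.le_ceil _
  set m := (searchSize (2 ^ 17) d ε δ n : ℝ) with hmdef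
  have hm1 : 2 ^ 17 * n ^ 2 * ℓ ≤ m * ε ^ 4 := by
    rw [← mul_div_assoc, div_le_iff₀ (by positivity)] at hm
    refine le_trans ?_ hm
    have : 2 ^ 17 * (d * n ^ 2 * ℓ) = (2 ^ 17 * n ^ 2 * ℓ) * d := by ring
    rw [this]
    exact le_mul_of_one_le_right (by positivity) hdR
  have hm0 : 0 < m := by
    have : 0 < m * ε ^ 4 := lt_of_lt_of_le (by positivity) hm1
    exact pos_of_mul_pos_left this (by positivity)
  refine ⟨Nat.cast_pos.1 hm0, ?_, ?_⟩
  · have h1 : ε / 8 * (ε / (4 * n)) * m = ε ^ 2 * m / (32 * n) := by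
      field_simp
      ring
    rw [h1, le_div_iff₀ (by positivity)]
    have h2 : m * ε ^ 4 ≤ ε ^ 2 * m := by
      have : ε ^ 4 ≤ ε ^ 2 := pow_le_pow_of_le_one hε.le hε1 (by norm_num)
      nlinarith
    have h3 : (2 : ℝ) ^ 17 * n ^ 2 * 1 ≤ 2 ^ 17 * n ^ 2 * ℓ := by gcongr
    nlinarith
  · set a := ε ^ 4 / (16384 * n ^ 2) with ha
    have ha0 : 0 < a := by positivity
    have e1 : (ε / 8 * (ε / (4 * n))) ^ 2 * m / 16 = m * a := by
      rw [ha]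
      field_simp
      ring
    have hma : 8 * ℓ ≤ m * a := by
      rw [ha, ← mul_div_assoc, le_div_iff₀ (by positivity)]
      linarith
    have hx : m * Real.exp (-(m * a)) ≤ 2 / a * Real.exp (-(4 * ℓ)) := by
      have h1 : m * a / 2 ≤ Real.exp (m * a / 2) := by
        linarith [Real.add_one_le_exp (m * a / 2)]
      have h2 : Real.exp (-(m * a)) = Real.exp (-(m * a / 2)) * Real.exp (-(m * a / 2)) := by
        rw [← Real.exp_add]; ring_nf
      have h3 : m * a / 2 * Real.exp (-(m * a / 2)) ≤ 1 := by
        calc _ ≤ Real.exp (m * a / 2) * Real.exp (-(m * a / 2)) := by gcongr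
          _ = 1 := by rw [← Real.exp_add]; simp
      have h4 : Real.exp (-(m * a / 2)) ≤ Real.exp (-(4 * ℓ)) := Real.exp_le_exp.2 (by linarith)
      calc m * Real.exp (-(m * a)) =
          2 / a * ((m * a / 2 * Real.exp (-(m * a / 2))) * Real.exp (-(m * a / 2))) := by
            rw [h2]; field_simp
        _ ≤ 2 / a * (1 * Real.exp (-(4 * ℓ))) := by gcongr
        _ = _ := by rw [one_mul]
    have he : Real.exp (-(4 * ℓ)) ≤ (n / (δ * ε) : ℝ)⁻¹ ^ 4 :=
      exp_neg_log_bound (by positivity) hℓ'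
    rw [e1, mul_assoc]
    calc 2 * n * (m * Real.exp (-(m * a))) ≤
        2 * n * (2 / a * (n / (δ * ε) : ℝ)⁻¹ ^ 4) := by
          refine mul_le_mul_of_nonneg_left (hx.trans ?_) (by positivity)
          exact mul_le_mul_of_nonneg_left he (by positivity)
      _ = 65536 * δ ^ 3 / n * δ := by
        rw [ha]
        field_simp
        ring
      _ ≤ 1 / 3 * δ := by
        refine mul_le_mul_of_nonneg_right ?_ hδ.le
        rw [div_le_iff₀ (by positivity)]
        have : δ ^ 3 ≤ 1 := pow_le_one₀ hδ.le hδ1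
        nlinarith
      _ = δ / 3 := by ring

theorem testSize_bounds (hε : 0 < ε) (hδ : 0 < δ) (hδ1 : δ ≤ 1) :
    0 < testSize ε δ ∧ 2 * Real.exp (-((ε / 2) ^ 2 * (testSize ε δ : ℝ) / 4)) ≤ δ / 3 := by
  have hL : 0 < Real.log (6 / δ) := Real.log_pos (by rw [lt_div_iff₀ hδ]; linarith)
  have hu : 20 * Real.log (6 / δ) / ε ^ 2 ≤ (testSize ε δ : ℝ) := Nat.le_ceil _
  rw [div_le_iff₀ (by positivity)] at hu
  constructor
  · exact Nat.ceil_pos.2 (by positivity)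
  · have : Real.exp (-((ε / 2) ^ 2 * (testSize ε δ : ℝ) / 4)) ≤ δ / 6 := by
      have e : δ / 6 = Real.exp (-Real.log (6 / δ)) := by
        rw [← Real.log_inv, Real.exp_log (by positivity), inv_div]
      rw [e, Real.exp_le_exp]
      linarith
    linarith

end Parameters

/-! ### Deviation events -/

/-- Pairs of points, compared through their distances to a third one. -/
def closedRelation (d : ℕ) : Set ((Euc d × Euc d) × Euc d) :=
  {w | dist w.2 w.1.1 ≤ dist w.1.2 w.1.1}

/-- The strict version of `closedRelation`. -/
def openRelation (d : ℕ) : Set ((Euc d × Euc d) × Euc d) :=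
  {w | dist w.2 w.1.1 < dist w.1.2 w.1.1}

theorem measurableSet_closedRelation : MeasurableSet (closedRelation d) :=
  measurableSet_le (by fun_prop) (by fun_prop)

theorem measurableSet_openRelation : MeasurableSet (openRelation d) :=
  measurableSet_lt (by fun_prop) (by fun_prop)

section Deviations

/-- The number of sample points in `B` deviates from its mean, in the direction `σ`, by more than
`η` times the larger of this mean and `b`. -/
def Deviates {α : Type*} [MeasurableSpace α] (q : Measure α) {N : ℕ} (Z : Fin N → α) (B : Set α)
    (σ η b : ℝ) : Prop :=
  η * max (N * q.real B) b < σ * (hitCount Z B - N * q.real B)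

theorem abs_ballCount_sub_le_of_not_deviates {N : ℕ} {Z : Fin N → Euc d} {x : Euc d}
    {q : Measure (Euc d)} [IsProbabilityMeasure q] {η b : ℝ} (hη : 0 ≤ η) (hη1 : η ≤ 1)
    (hb : 0 ≤ b)
    (hU : ∀ j, ¬ Deviates q Z {z | ((x, Z j), z) ∈ closedRelation d} 1 η b)
    (hL : ∀ j, ¬ Deviates q Z {z | ((x, Z j), z) ∈ openRelation d} (-1) η b) (r : ℝ) :
    |(ballCount Z x r : ℝ) - N * q.real (Metric.closedBall x r)| ≤
      η * max (N * q.real (Metric.closedBall x r)) b := by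
  refine abs_ballCount_sub_le Z x q hη hη1 hb (fun j => ?_) (fun j => ?_) r
  · have h := not_lt.1 (hU j)
    rwa [one_mul] at h
  · have h := not_lt.1 (hL j)
    rwa [neg_one_mul, neg_sub] at h

end Deviations

/-! ### The training sample -/

section TrainingSample

variable (p : Measure (Euc d)) [IsProbabilityMeasure p]

theorem ae_pi_eval {n : ℕ} {P : Euc d → Prop} (h : ∀ᵐ x ∂p, P x) :
    ∀ᵐ S ∂(Measure.pi fun _ : Fin n => p), ∀ i, P (S i) :=
  ae_all_iff.2 fun i =>
    (measurePreserving_eval (fun _ : Fin n => p) i).quasiMeasurePreserving.ae h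

/-- Resampling the l-th point leaves centre and radius unchanged, so the fresh point would have to
fall on a null sphere. -/
theorem ae_dist_ne {n : ℕ} {c : ℝ} (hnull : HasNullSpheresBelow p c) {i j l : Fin n} (hli : l ≠ i)
    (hlj : l ≠ j) : ∀ᵐ S ∂(Measure.pi fun _ : Fin n => p),
      p.real (Metric.ball (S i) (dist (S j) (S i))) < c → dist (S l) (S i) ≠ dist (S j) (S i) := by
  have hij : Measurable fun S : Fin n → Euc d => (S i, S j) :=
    (measurable_pi_apply i).prodMk (measurable_pi_apply j)
  have hV : ∀ S : Fin n → Euc d, Metric.ball (S i) (dist (S j) (S i)) =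
      Prod.mk (S i, S j) ⁻¹' openRelation d := fun S => rfl
  have hreal : Measurable fun S : Fin n → Euc d =>
      p.real (Metric.ball (S i) (dist (S j) (S i))) := by
    simp only [hV, measureReal_def]
    exact ((measurable_measure_prodMk_left (ν := p)
      (measurableSet_openRelation (d := d))).comp hij).ennreal_toReal
  have hE : MeasurableSet {S : Fin n → Euc d |
      p.real (Metric.ball (S i) (dist (S j) (S i))) < c ∧
        dist (S l) (S i) = dist (S j) (S i)} :=
    (measurableSet_lt hreal measurable_const).inter
      (measurableSet_eq_fun ((measurable_pi_apply l).dist (measurable_pi_apply i))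
        ((measurable_pi_apply j).dist (measurable_pi_apply i)))
  set E := {S : Fin n → Euc d | p.real (Metric.ball (S i) (dist (S j) (S i))) < c ∧
        dist (S l) (S i) = dist (S j) (S i)}
  suffices h : (Measure.pi fun _ : Fin n => p) E = 0 by
    refine measure_mono_null (fun S hS => ?_) h
    simp only [Set.mem_compl_iff, Set.mem_ofPred_eq, not_forall, not_not] at hS
    exact ⟨hS.choose, hS.choose_spec⟩
  rw [← (measurePreserving_update p l).measure_preimage hE.nullMeasurableSet,
    Measure.prod_apply (measurable_update_prod l hE), lintegral_eq_zero_iff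
    (measurable_measure_prodMk_left (measurable_update_prod l hE))]
  filter_upwards [ae_pi_eval (n := n) p hnull] with S hS
  by_cases hb : p.real (Metric.ball (S i) (dist (S j) (S i))) < c
  · refine measure_mono_null (fun x hx => ?_) (hS i _ dist_nonneg hb)
    have hx' : Function.update S l x ∈ E := hx
    have h2 := hx'.2
    rw [Function.update_of_ne hli.symm, Function.update_of_ne hlj.symm, Function.update_self] at h2
    exact Metric.mem_sphere.2 h2
  · refine measure_mono_null (t := ∅) (fun x hx => ?_) measure_empty
    have hx' : Function.update S l x ∈ E := hx
    have h1 := hx'.1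
    rw [Function.update_of_ne hli.symm, Function.update_of_ne hlj.symm] at h1
    exact hb h1

/-- With high probability the training sample is accurate on all balls around its points, and all
anchor radii are attained. -/
theorem exists_bad_samples {n b : ℕ} {c η : ℝ} (hnull : HasNullSpheresBelow p c)
    (hη : 0 ≤ η) (hη2 : η ≤ 1 / 2) (hb2 : 2 ≤ b) (hbn : b ≤ n) (hbc : 2 * (b : ℝ) ≤ n * c)
    (hηb : 4 ≤ η * b) :
    ∃ E : Set (Fin n → Euc d), (Measure.pi fun _ => p) E ≤
        ENNReal.ofReal (2 * n * n * Real.exp (-(η ^ 2 * b / 16))) ∧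
      ∀ S ∉ E, (∀ i, S i ∈ p.support) ∧
        (∀ i r, |(ballCount S (S i) r : ℝ) - n * p.real (Metric.closedBall (S i) r)| ≤
          η * max (n * p.real (Metric.closedBall (S i) r)) b) ∧
        ∀ i, 0 < anchorRadius b S (S i) ∧ ballCount S (S i) (anchorRadius b S (S i)) = b := by
  have hn : (0 : ℝ) < n := by
    have : 0 < n := by omega
    exact_mod_cast this
  let D : Set ((Euc d × Euc d) × Euc d) → ℝ → Fin n → Fin n → Set (Fin n → Euc d) :=
    fun V σ i j => {S | Deviates p S {z | ((S i, S j), z) ∈ V} σ η b}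
  let e := Real.exp (-(η ^ 2 * b / 16))
  have hD : ∀ V σ, MeasurableSet V → |σ| = 1 →
      (Measure.pi fun _ => p) (⋃ i, ⋃ j, D V σ i j) ≤ ENNReal.ofReal (n * n * e) := by
    intro V σ hV hσ
    calc _ ≤ ∑ i : Fin n, ∑ j : Fin n, (Measure.pi fun _ => p) (D V σ i j) :=
          (measure_iUnion_fintype_le _ _).trans
            (Finset.sum_le_sum fun i _ => measure_iUnion_fintype_le _ _)
      _ ≤ ∑ i : Fin n, ∑ j : Fin n, ENNReal.ofReal e :=
          Finset.sum_le_sum fun i _ => Finset.sum_le_sum fun j _ =>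
            chernoff_two_point p hV i j hσ hη (by linarith) hηb
      _ = _ := by
        simp only [Finset.sum_const, Finset.card_univ, Fintype.card_fin, nsmul_eq_mul]
        rw [ENNReal.ofReal_mul (by positivity), ENNReal.ofReal_mul (by positivity),
          ENNReal.ofReal_natCast, mul_assoc]
  have hae : ∀ᵐ S ∂(Measure.pi fun _ : Fin n => p), (∀ i, S i ∈ p.support) ∧
      ∀ i j l, l ≠ i → l ≠ j → p.real (Metric.ball (S i) (dist (S j) (S i))) < c →
        dist (S l) (S i) ≠ dist (S j) (S i) := by
    refine (ae_pi_eval p Measure.support_mem_ae).and ?_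
    simp only [ae_all_iff]
    exact fun i j l hli hlj => ae_dist_ne p hnull hli hlj
  refine ⟨(⋃ i, ⋃ j, D (closedRelation d) 1 i j) ∪ (⋃ i, ⋃ j, D (openRelation d) (-1) i j) ∪
    {S | ¬((∀ i, S i ∈ p.support) ∧
      ∀ i j l, l ≠ i → l ≠ j → p.real (Metric.ball (S i) (dist (S j) (S i))) < c →
        dist (S l) (S i) ≠ dist (S j) (S i))}, ?_, ?_⟩
  · refine (measure_union_le _ _).trans ?_
    rw [ae_iff.1 hae, add_zero]
    refine (measure_union_le _ _).trans ((add_le_add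
      (hD _ _ measurableSet_closedRelation (by simp))
      (hD _ _ measurableSet_openRelation (by simp))).trans ?_)
    rw [← ENNReal.ofReal_add (by positivity) (by positivity)]
    exact ENNReal.ofReal_le_ofReal (le_of_eq (by ring))
  · intro S hS
    simp only [Set.mem_union, not_or, Set.mem_iUnion, not_exists, Set.mem_ofPred_eq,
      not_not] at hS
    obtain ⟨⟨hU, hL⟩, hsupp, hne⟩ := hS
    have hL' : ∀ i j, n * p.real (Metric.ball (S i) (dist (S j) (S i))) -
        (hitCount S (Metric.ball (S i) (dist (S j) (S i))) : ℝ) ≤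
        η * max (n * p.real (Metric.ball (S i) (dist (S j) (S i)))) b := by
      intro i j
      have h := not_lt.1 (show ¬ Deviates p S _ (-1) η b from hL i j)
      rwa [neg_one_mul, neg_sub] at h
    refine ⟨hsupp, fun i r => abs_ballCount_sub_le_of_not_deviates hη (by linarith)
      (Nat.cast_nonneg b) (hU i) (hL i) r, fun i => ?_⟩
    refine anchorRadius_spec S i hb2 hbn fun j hj l hlj => ?_
    -- An open ball of mass at least c has expected count at least 2b, hence count at least b since
    -- η ≤ 1/2. So the no-ties condition covers every ball with fewer than b points.
    have hsmall : p.real (Metric.ball (S i) (dist (S j) (S i))) < c := by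
      by_contra hcon
      have h1 := mul_le_mul_of_nonneg_left (not_lt.1 hcon) hn.le
      have h2 := hL' i j
      have hb0 : (0 : ℝ) ≤ b := Nat.cast_nonneg b
      rw [max_eq_left (by linarith)] at h2
      have h3 : (hitCount S (Metric.ball (S i) (dist (S j) (S i))) : ℝ) < b := by
        exact_mod_cast hj
      have h4 := mul_le_mul_of_nonneg_right hη2
        (by positivity : 0 ≤ n * p.real (Metric.ball (S i) (dist (S j) (S i))))
      linarith
    -- If l is the centre, the tie says that the j-th point coincides with it; then j plays the role
    -- of the resampled point at radius 0.
    by_cases hli : l = i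
    · subst hli
      intro heq
      refine hne l l j hlj.symm hlj.symm ?_ heq.symm
      rwa [heq]
    · exact hne i j l hli hlj hsmall

end TrainingSample

/-! ### The oracle samples -/

section OracleSamples

theorem measurePreserving_castAdd (q : Measure (Euc d)) [IsProbabilityMeasure q] (m u : ℕ) :
    MeasurePreserving (fun (ω : Fin (m + u) → Euc d) (j : Fin m) => ω (Fin.castAdd u j))
      (Measure.pi fun _ => q) (Measure.pi fun _ => q) := by
  have hm : Measurable fun (ω : Fin (m + u) → Euc d) (j : Fin m) => ω (Fin.castAdd u j) :=
    measurable_pi_lambda _ fun j => measurable_pi_apply _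
  refine ⟨hm, ?_⟩
  have h := measurePreserving_append q m u
  rw [← h.map_eq, Measure.map_map hm h.measurable]
  have : (fun (ω : Fin (m + u) → Euc d) (j : Fin m) => ω (Fin.castAdd u j)) ∘
      (fun w : (Fin m → Euc d) × (Fin u → Euc d) => Fin.append w.1 w.2) = Prod.fst := by
    ext w j
    simp
  rw [this]
  exact measurePreserving_fst.map_eq

variable (p : Measure (Euc d)) [IsProbabilityMeasure p] (A : GenerativeAlgorithm d)

/-- Given S and q, the oracle samples are i.i.d. from q, so a bound valid for every pair makes the
dependence of q on S irrelevant. -/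
theorem trialLaw_le_of_forall {n N : ℕ}
    {E : Set (((Fin n → Euc d) × ProbabilityMeasure (Euc d)) × (Fin N → Euc d))}
    (hE : MeasurableSet E) {c : ENNReal}
    (h : ∀ a, (Measure.pi fun _ : Fin N => (a.2 : Measure (Euc d))) {ω | (a, ω) ∈ E} ≤ c) :
    trialLaw p A n N E ≤ c := by
  rw [trialLaw, Measure.compProd_apply hE]
  calc _ ≤ ∫⁻ _, c ∂((Measure.pi fun _ : Fin n => p) ⊗ₘ A.law n) := lintegral_mono fun a => h a
    _ = c := by simp

/-- Only an inequality, because E is not assumed measurable. -/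
theorem trialLaw_sample_le {n N : ℕ} (E : Set (Fin n → Euc d)) :
    trialLaw p A n N {ω | ω.1.1 ∈ E} ≤ (Measure.pi fun _ => p) E := by
  have h : (trialLaw p A n N).map (fun ω => ω.1.1) = Measure.pi fun _ => p := by
    have h1 : (trialLaw p A n N).map Prod.fst = (Measure.pi fun _ : Fin n => p) ⊗ₘ A.law n :=
      Measure.fst_compProd _ _
    have h2 : ((Measure.pi fun _ : Fin n => p) ⊗ₘ A.law n).map Prod.fst = Measure.pi fun _ => p :=
      Measure.fst_compProd _ _
    rw [← h2, ← h1, Measure.map_map measurable_fst measurable_fst]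
    rfl
  rw [← h]
  exact Measure.le_map_apply (measurable_fst.comp measurable_fst).aemeasurable E

/-- The generated distribution, as a kernel on a space where it can be observed. -/
noncomputable def generatedKernel {Ω : Type*} [MeasurableSpace Ω]
    (f : Ω → ProbabilityMeasure (Euc d)) (hf : Measurable f) : Kernel Ω (Euc d) where
  toFun ω := (f ω : Measure (Euc d))
  measurable' := measurable_subtype_coe.comp hf

theorem measurable_generated_real {Ω : Type*} [MeasurableSpace Ω]
    {f : Ω → ProbabilityMeasure (Euc d)} (hf : Measurable f) {V : Set (Ω × Euc d)}
    (hV : MeasurableSet V) :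
    Measurable fun ω => (f ω : Measure (Euc d)).real {z | (ω, z) ∈ V} := by
  have : IsMarkovKernel (generatedKernel f hf) :=
    ⟨fun ω => inferInstanceAs (IsProbabilityMeasure (f ω : Measure (Euc d)))⟩
  exact (Kernel.measurable_kernel_prodMk_left (κ := generatedKernel f hf) hV).ennreal_toReal

/-- With b = m the maximum in the threshold equals m, so the error is additive. For fixed S the ball
depends on a single point of T. -/
theorem trialLaw_deviates_le {n m u : ℕ} {V : Set ((Euc d × Euc d) × Euc d)}
    (hV : MeasurableSet V) (i : Fin n) (j : Fin m) {σ t : ℝ} (hσ : |σ| = 1) (ht : 0 ≤ t)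
    (ht1 : t ≤ 1) (htm : 4 ≤ t * m) :
    trialLaw p A n (m + u) {ω | Deviates (ω.1.2 : Measure (Euc d))
      (fun j => ω.2 (Fin.castAdd u j)) {z | ((ω.1.1 i, ω.2 (Fin.castAdd u j)), z) ∈ V} σ t m} ≤
      ENNReal.ofReal (Real.exp (-(t ^ 2 * m / 16))) := by
  have hT : Measurable fun (ω : ((Fin n → Euc d) × ProbabilityMeasure (Euc d)) ×
      (Fin (m + u) → Euc d)) (j : Fin m) => ω.2 (Fin.castAdd u j) :=
    measurable_pi_lambda _ fun j => (measurable_pi_apply _).comp measurable_snd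
  have hq : Measurable fun ω : ((Fin n → Euc d) × ProbabilityMeasure (Euc d)) ×
      (Fin (m + u) → Euc d) => ω.1.2 := measurable_snd.comp measurable_fst
  have hV' : MeasurableSet {w : (((Fin n → Euc d) × ProbabilityMeasure (Euc d)) ×
      (Fin (m + u) → Euc d)) × Euc d | ((w.1.1.1 i, w.1.2 (Fin.castAdd u j)), w.2) ∈ V} := by
    have h : Measurable fun w : (((Fin n → Euc d) × ProbabilityMeasure (Euc d)) ×
        (Fin (m + u) → Euc d)) × Euc d => ((w.1.1.1 i, w.1.2 (Fin.castAdd u j)), w.2) :=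
      (((measurable_pi_apply i).comp
        (measurable_fst.comp (measurable_fst.comp measurable_fst))).prodMk
        ((measurable_pi_apply _).comp (measurable_snd.comp measurable_fst))).prodMk measurable_snd
    exact h hV
  have hQ := measurable_generated_real hq hV'
  have hN := measurable_hitCount hV' hT
  refine trialLaw_le_of_forall p A
    (measurableSet_lt (((hQ.const_mul (m : ℝ)).max measurable_const).const_mul t)
      ((hN.sub (hQ.const_mul (m : ℝ))).const_mul σ)) fun a => ?_
  have hV'' : MeasurableSet {w : Euc d × Euc d | ((a.1 i, w.1), w.2) ∈ V} :=
    ((measurable_const.prodMk measurable_fst).prodMk measurable_snd) hV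
  have hmp := measurePreserving_castAdd (a.2 : Measure (Euc d)) m u
  have hch := chernoff_one_point (a.2 : Measure (Euc d)) hV'' j hσ ht (by linarith) htm
  rw [← hmp.map_eq] at hch
  exact (Measure.le_map_apply hmp.measurable.aemeasurable _).trans hch

/-- With high probability the search sample is accurate on all balls around training points. -/
theorem trialLaw_search_le {n m u : ℕ} {t : ℝ} (ht : 0 ≤ t) (ht1 : t ≤ 1) (htm : 4 ≤ t * m) :
    trialLaw p A n (m + u) {ω | ¬ ∀ i r,
      |(ballCount (fun j => ω.2 (Fin.castAdd u j)) (ω.1.1 i) r : ℝ) -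
        m * (ω.1.2 : Measure (Euc d)).real (Metric.closedBall (ω.1.1 i) r)| ≤ t * m} ≤
      ENNReal.ofReal (2 * n * m * Real.exp (-(t ^ 2 * m / 16))) := by
  set e := Real.exp (-(t ^ 2 * m / 16)) with he
  have he0 : 0 ≤ e := (Real.exp_pos _).le
  have hD : ∀ V σ, MeasurableSet V → |σ| = 1 →
      trialLaw p A n (m + u) (⋃ (i : Fin n), ⋃ (j : Fin m),
        {ω | Deviates (ω.1.2 : Measure (Euc d)) (fun j => ω.2 (Fin.castAdd u j))
          {z | ((ω.1.1 i, ω.2 (Fin.castAdd u j)), z) ∈ V} σ t m}) ≤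
        ENNReal.ofReal (n * m * e) := by
    intro V σ hV hσ
    refine (measure_iUnion_fintype_le _ _).trans ((Finset.sum_le_sum fun i _ =>
      (measure_iUnion_fintype_le _ _).trans (Finset.sum_le_sum fun j _ =>
        trialLaw_deviates_le p A hV i j hσ ht ht1 htm)).trans ?_)
    rw [← he]
    simp only [Finset.sum_const, Finset.card_univ, Fintype.card_fin, nsmul_eq_mul]
    rw [ENNReal.ofReal_mul (by positivity), ENNReal.ofReal_mul (by positivity),
      ENNReal.ofReal_natCast, ENNReal.ofReal_natCast, mul_assoc]
  have hC := hD _ 1 (measurableSet_closedRelation (d := d)) (by simp)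
  have hO := hD _ (-1) (measurableSet_openRelation (d := d)) (by simp)
  refine (measure_mono fun ω hω => ?_).trans
    ((measure_union_le _ _).trans ((add_le_add hC hO).trans ?_))
  · by_contra hcon
    simp only [Set.mem_union, not_or, Set.mem_iUnion, not_exists] at hcon
    refine hω fun i r => ?_
    have h := abs_ballCount_sub_le_of_not_deviates (q := (ω.1.2 : Measure (Euc d)))
      ht ht1 (Nat.cast_nonneg m) (hcon.1 i) (hcon.2 i) r
    rwa [max_eq_right (mul_le_of_le_one_right (Nat.cast_nonneg m) measureReal_le_one)] at h
  · rw [← ENNReal.ofReal_add (by positivity) (by positivity)]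
    exact ENNReal.ofReal_le_ofReal (le_of_eq (by ring))

theorem measurableSet_detectRegion_right {n m k b : ℕ} {lam gam : ℝ} (S : Fin n → Euc d)
    (T : Fin m → Euc d) : MeasurableSet (detectRegion k b lam gam S T) := by
  have h := measurableSet_detectRegion (k := k) (b := b) (lam := lam) (gam := gam) (Ω := Unit)
    (S := fun _ => S) (T := fun _ => T) measurable_const measurable_const
  exact measurable_prodMk_left (x := ()) h

/-- Conditioning on S, q and T fixes the region, and U is independent of it; no resampling is
needed. -/
theorem trialLaw_region_deviates_le {n m u : ℕ} (k b : ℕ) (lam gam : ℝ) {σ η : ℝ} (hσ : |σ| = 1)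
    (hη : 0 ≤ η) (hη1 : η ≤ 2) :
    trialLaw p A n (m + u) {ω | Deviates (ω.1.2 : Measure (Euc d))
      (fun j => ω.2 (Fin.natAdd m j))
      {z | z ∈ detectRegion k b lam gam ω.1.1 fun j => ω.2 (Fin.castAdd u j)} σ η u} ≤
      ENNReal.ofReal (Real.exp (-(η ^ 2 * u / 4))) := by
  have hT : Measurable fun (ω : ((Fin n → Euc d) × ProbabilityMeasure (Euc d)) ×
      (Fin (m + u) → Euc d)) (j : Fin m) => ω.2 (Fin.castAdd u j) :=
    measurable_pi_lambda _ fun j => (measurable_pi_apply _).comp measurable_snd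
  have hU : Measurable fun (ω : ((Fin n → Euc d) × ProbabilityMeasure (Euc d)) ×
      (Fin (m + u) → Euc d)) (j : Fin u) => ω.2 (Fin.natAdd m j) :=
    measurable_pi_lambda _ fun j => (measurable_pi_apply _).comp measurable_snd
  have hS : Measurable fun ω : ((Fin n → Euc d) × ProbabilityMeasure (Euc d)) ×
      (Fin (m + u) → Euc d) => ω.1.1 := measurable_fst.comp measurable_fst
  have hq : Measurable fun ω : ((Fin n → Euc d) × ProbabilityMeasure (Euc d)) ×
      (Fin (m + u) → Euc d) => ω.1.2 := measurable_snd.comp measurable_fst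
  have hW := measurableSet_detectRegion (k := k) (b := b) (lam := lam) (gam := gam) hS hT
  have hQ := measurable_generated_real hq hW
  have hN := measurable_hitCount hW hU
  have hE := measurableSet_lt
    (((hQ.const_mul (u : ℝ)).max (measurable_const (a := (u : ℝ)))).const_mul η)
    ((hN.sub (hQ.const_mul (u : ℝ))).const_mul σ)
  refine trialLaw_le_of_forall p A hE fun a => ?_
  have hs := measurable_prodMk_left (x := a) hE
  have happ := measurePreserving_append (a.2 : Measure (Euc d)) m u
  refine (happ.measure_preimage hs.nullMeasurableSet).symm.le.trans ?_
  rw [Measure.prod_apply (happ.measurable hs)]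
  refine (lintegral_mono fun T' => ?_).trans (b :=
    ∫⁻ _ : Fin m → Euc d, ENNReal.ofReal (Real.exp (-(η ^ 2 * u / 4)))
      ∂(Measure.pi fun _ => (a.2 : Measure (Euc d)))) (by simp)
  refine (measure_mono fun U' hU' => ?_).trans (chernoff_deviation
    (a.2 : Measure (Euc d)) (measurableSet_detectRegion_right (k := k) (b := b) (lam := lam)
      (gam := gam) a.1 T') (n := u) hσ hη hη1
    (mul_le_of_le_one_right (Nat.cast_nonneg u) measureReal_le_one))
  have hU'' : Deviates (a.2 : Measure (Euc d))
      (fun j => (Fin.append T' U' : Fin (m + u) → Euc d) (Fin.natAdd m j))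
      (detectRegion k b lam gam a.1 fun j =>
        (Fin.append T' U' : Fin (m + u) → Euc d) (Fin.castAdd u j)) σ η u := hU'
  simp only [Fin.append_left, Fin.append_right] at hU''
  unfold Deviates at hU''
  rw [max_eq_right (mul_le_of_le_one_right (Nat.cast_nonneg u) measureReal_le_one)] at hU''
  exact hU''.le

/-- With high probability the test sample estimates the mass of the region found so far. -/
theorem trialLaw_test_le {n m u : ℕ} (k b : ℕ) (lam gam : ℝ) {η : ℝ} (hη : 0 ≤ η) (hη1 : η ≤ 2) :
    trialLaw p A n (m + u) {ω | ¬
      |(hitCount (fun j => ω.2 (Fin.natAdd m j))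
          (detectRegion k b lam gam ω.1.1 fun j => ω.2 (Fin.castAdd u j)) : ℝ) -
        u * (ω.1.2 : Measure (Euc d)).real
          (detectRegion k b lam gam ω.1.1 fun j => ω.2 (Fin.castAdd u j))| ≤ η * u} ≤
      ENNReal.ofReal (2 * Real.exp (-(η ^ 2 * u / 4))) := by
  have h1 := trialLaw_region_deviates_le p A (n := n) (m := m) (u := u) k b lam gam (σ := 1)
    (by simp) hη hη1
  have h2 := trialLaw_region_deviates_le p A (n := n) (m := m) (u := u) k b lam gam (σ := -1)
    (by simp) hη hη1
  refine (measure_mono fun ω hω => ?_).trans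
    ((measure_union_le _ _).trans ((add_le_add h1 h2).trans ?_))
  · have hmax := max_eq_right (mul_le_of_le_one_right (Nat.cast_nonneg (α := ℝ) u)
      (measureReal_le_one (μ := (ω.1.2 : Measure (Euc d)))
        (s := detectRegion k b lam gam ω.1.1 fun j => ω.2 (Fin.castAdd u j))))
    rcases lt_abs.1 (not_le.1 hω) with h | h
    · left
      show Deviates _ _ (detectRegion k b lam gam ω.1.1 fun j => ω.2 (Fin.castAdd u j)) 1 η u
      rw [Deviates, hmax, one_mul]
      exact h
    · right
      show Deviates _ _ (detectRegion k b lam gam ω.1.1 fun j => ω.2 (Fin.castAdd u j)) (-1) η u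
      rw [Deviates, hmax, neg_one_mul]
      exact h
  · rw [← ENNReal.ofReal_add (by positivity) (by positivity)]
    exact ENNReal.ofReal_le_ofReal (le_of_eq (by ring))

end OracleSamples

/-! ### Trivial cases and assembly -/

theorem detectOutput_mem_Icc {n m u : ℕ} (k b : ℕ) (lam gam : ℝ) (S : Fin n → Euc d)
    (T : Fin m → Euc d) (U : Fin u → Euc d) : detectOutput k b lam gam S T U ∈ Set.Icc (0 : ℝ) 1 := by
  rw [detectOutput_eq]
  refine ⟨by positivity, div_le_one_of_le₀ ?_ (Nat.cast_nonneg u)⟩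
  exact_mod_cast hitCount_le U _

theorem sampleComplexityAtMost_of_one_le_delta (D : ℝ → ℝ → DataCopyDetector d)
    (p : Measure (Euc d)) [IsProbabilityMeasure p] {ε δ : ℝ} (hδ : 1 ≤ δ) (M : ℝ) :
    SampleComplexityAtMost D p ε δ M := fun _ _ _ _ _ _ _ _ =>
  prob_le_one.trans (ENNReal.one_le_ofReal.2 hδ)

theorem sampleComplexityAtMost_of_one_le_epsilon (p : Measure (Euc d)) (c₁ c₂ : ℝ) (k : ℕ)
    {ε δ : ℝ} (hε : 1 ≤ ε) (M : ℝ) :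
    SampleComplexityAtMost (dataCopyDetect d c₁ c₂ k ε δ) p ε δ M := by
  intro n _ lam gam _ _ _ A
  have : failureEvent p (dataCopyDetect d c₁ c₂ k ε δ lam gam) lam gam ε n = ∅ := by
    refine Set.eq_empty_iff_forall_notMem.2 fun ω hω => hω ?_
    obtain ⟨h0, h1⟩ := detectOutput_mem_Icc k (anchorCount c₁ d ε δ n) lam gam ω.1.1
      (fun j : Fin (searchSize c₂ d ε δ n) => ω.2 (Fin.castAdd (testSize ε δ) j))
      (fun j : Fin (testSize ε δ) => ω.2 (Fin.natAdd (searchSize c₂ d ε δ n) j))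
    have hl : copyRateLower p ω.1.1 ω.1.2 lam gam ε ≤ 1 := measureReal_le_one
    have hu : 0 ≤ copyRateUpper p ω.1.1 ω.1.2 lam gam ε := measureReal_nonneg
    exact ⟨le_trans (by linarith) h0, h1.trans (by linarith)⟩
  rw [this, measure_empty]
  exact zero_le

theorem trialLaw_failure_le (hd : 2 ≤ d) (p : Measure (Euc d)) [IsProbabilityMeasure p] {k : ℕ}
    (hk : 0 < k) {ε δ c : ℝ} (hε : 0 < ε) (hε1 : ε ≤ 1) (hδ : 0 < δ) (hδ1 : δ ≤ 1)
    (hreg : IsRegularityConstant p k ε c) (hnull : HasNullSpheresBelow p c) {n : ℕ}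
    (hn : 2 ^ 20 * (d * Real.log (d / (δ * ε * c)) / (ε ^ 2 * c)) ≤ n) {lam gam : ℝ}
    (hlam : 0 < lam) (hgam : 0 < gam) (A : GenerativeAlgorithm d) :
    trialLaw p A n ((dataCopyDetect d 4096 (2 ^ 17) k ε δ lam gam).draws n)
      (failureEvent p (dataCopyDetect d 4096 (2 ^ 17) k ε δ lam gam) lam gam ε n) ≤
        ENNReal.ofReal δ := by
  have hc0 := hreg.1
  have hc1 := hreg.2.1
  have hd0 : 0 < d := by omega
  obtain ⟨hn19, hbc⟩ := log_parameter_bounds hd hε hε1 hδ hδ1 hc0 hc1 hn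
  have hnR : (0 : ℝ) < n := by linarith
  have hn0 : 0 < n := by exact_mod_cast hnR
  obtain ⟨hb2, hεb, hbprob⟩ := anchorCount_bounds hd0 hε hε1 hδ hδ1 hn19
  obtain ⟨hm0, htm, hmprob⟩ := searchSize_bounds hd0 hε hε1 hδ hδ1 hn19
  obtain ⟨hu0, huprob⟩ := testSize_bounds hε hδ hδ1
  have hbc' : 2 * (anchorCount 4096 d ε δ n : ℝ) ≤ n * c := by
    have hnδ : 0 ≤ Real.log (n / δ) := Real.log_nonneg (by rw [le_div_iff₀ hδ]; linarith)
    have := Nat.ceil_lt_add_one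
      (show (0 : ℝ) ≤ 4096 * (d * Real.log (n / δ) / ε ^ 2) by positivity)
    have h : (anchorCount 4096 d ε δ n : ℝ) ≤ 4096 * (d * Real.log (n / δ) / ε ^ 2) + 1 := this.le
    linarith
  have hbn : anchorCount 4096 d ε δ n ≤ n := by
    have h : (anchorCount 4096 d ε δ n : ℝ) ≤ n := by
      have := mul_le_mul_of_nonneg_left hc1 hnR.le
      have hb0 : (0 : ℝ) ≤ anchorCount 4096 d ε δ n := Nat.cast_nonneg _
      linarith
    exact_mod_cast h
  obtain ⟨E, hE, hgood⟩ := exists_bad_samples p hnull (by positivity : 0 ≤ ε / 8) (by linarith)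
    hb2 hbn hbc' hεb
  have ht0 : 0 ≤ ε / 8 * (ε / (4 * n)) := by positivity
  have ht1 : ε / 8 * (ε / (4 * n)) ≤ 1 := by
    have h1 : ε / (4 * n) ≤ 1 := (div_le_one (by positivity)).2 (by linarith)
    exact mul_le_one₀ (by linarith) (by positivity) h1
  have hS := (trialLaw_sample_le p A (N := searchSize (2 ^ 17) d ε δ n + testSize ε δ) E).trans
    (hE.trans (ENNReal.ofReal_le_ofReal hbprob))
  have hT := (trialLaw_search_le p A (n := n) (u := testSize ε δ) ht0 ht1 htm).trans
    (ENNReal.ofReal_le_ofReal hmprob)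
  have hU := (trialLaw_test_le p A (n := n) (m := searchSize (2 ^ 17) d ε δ n)
    (u := testSize ε δ) k (anchorCount 4096 d ε δ n) lam gam (η := ε / 2) (by positivity)
    (by linarith)).trans (ENNReal.ofReal_le_ofReal huprob)
  have hsum : ENNReal.ofReal (δ / 3) + ENNReal.ofReal (δ / 3) + ENNReal.ofReal (δ / 3) =
      ENNReal.ofReal δ := by
    rw [← ENNReal.ofReal_add (by positivity) (by positivity),
      ← ENNReal.ofReal_add (by positivity) (by positivity)]
    congr 1
    ring
  rw [← hsum]
  -- The failure event need not be measurable: it is covered by three bad events, each of outer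
  -- measure at most δ/3.
  refine (measure_mono fun ω hω => ?_).trans ((measure_union_le _ _).trans
    (add_le_add ((measure_union_le _ _).trans (add_le_add hS hT)) hU))
  by_contra hcon
  have hωE : ω.1.1 ∉ E := fun h => hcon (Or.inl (Or.inl h))
  have hωT := not_not.1 fun h => hcon (Or.inl (Or.inr h))
  have hωU := not_not.1 fun h => hcon (Or.inr h)
  obtain ⟨hsupp, hunif, hanchor⟩ := hgood ω.1.1 hωE
  have hatom : ∀ x : Euc d, p.real (Metric.closedBall x 0) = 0 := fun x => by
    rw [Metric.closedBall_zero, measureReal_def, measure_singleton_eq_zero hc0 hnull,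
      ENNReal.toReal_zero]
  obtain ⟨hlow, hup⟩ := region_bounds (k := k) (lam := lam) (gam := gam) (S := ω.1.1)
    (T := fun j => ω.2 (Fin.castAdd (testSize ε δ) j)) p (ω.1.2 : Measure (Euc d)) hn0 hm0
    hlam hgam hε hε1 rfl
    (fun i r s hr hrs => est_mono (hanchor i).1 (hanchor i).2 hr hrs)
    (fun i => est_zero hk (hanchor i).1)
    (fun i r hr => est_approx hn0 hk hε (by positivity) (by linarith) hreg (hsupp i) (hatom _)
      (hunif i) (hanchor i).1 (hanchor i).2 hbc' hr)
    hωT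
  refine hω ?_
  have huR : (0 : ℝ) < testSize ε δ := by exact_mod_cast hu0
  have hout : |detectOutput k (anchorCount 4096 d ε δ n) lam gam ω.1.1
      (fun j : Fin (searchSize (2 ^ 17) d ε δ n) => ω.2 (Fin.castAdd (testSize ε δ) j))
      (fun j : Fin (testSize ε δ) => ω.2 (Fin.natAdd (searchSize (2 ^ 17) d ε δ n) j)) -
      (ω.1.2 : Measure (Euc d)).real (detectRegion k (anchorCount 4096 d ε δ n) lam gam ω.1.1
        (fun j => ω.2 (Fin.castAdd (testSize ε δ) j)))| ≤ ε / 2 := by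
    rw [detectOutput_eq, div_sub' huR.ne', abs_div, abs_of_pos huR, div_le_iff₀ huR]
    exact hωU
  have key : ∀ D Q L H : ℝ, |D - Q| ≤ ε / 2 → L - ε / 2 ≤ Q → Q ≤ H + ε / 2 →
      L - ε ≤ D ∧ D ≤ H + ε := fun D Q L H h hL hH =>
    ⟨by linarith [(abs_le.1 h).1], by linarith [(abs_le.1 h).2]⟩
  exact key _ _ _ _ hout hlow hup

end DataCopying

theorem mainTheorem1 :
    ∃ c₁ c₂ C : ℝ, 0 < c₁ ∧ 0 < c₂ ∧ 0 < C ∧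
      ∀ (d : ℕ), 0 < d →
      ∀ (p : MeasureTheory.Measure (DataCopying.Euc d)) [MeasureTheory.IsProbabilityMeasure p]
        (k : ℕ), DataCopying.IsKRegular p k →
      ∀ (ε δ pε : ℝ), 0 < ε → 0 < δ → DataCopying.IsRegularityConstant p k ε pε →
        DataCopying.HasNullSpheresBelow p pε →
        DataCopying.SampleComplexityAtMost (DataCopying.dataCopyDetect d c₁ c₂ k ε δ) p ε δ
          (C * (d * Real.log (d / (δ * ε * pε)) / (ε ^ 2 * pε))) := by
  refine ⟨4096, 2 ^ 17, 2 ^ 20, by norm_num, by norm_num, by norm_num, ?_⟩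
  intro d hd p _ k hkreg ε δ c hε hδ hreg hnull
  rcases le_total 1 δ with hδ1 | hδ1
  · exact DataCopying.sampleComplexityAtMost_of_one_le_delta _ p hδ1 _
  rcases le_total 1 ε with hε1 | hε1
  · exact DataCopying.sampleComplexityAtMost_of_one_le_epsilon p _ _ k hε1 _
  -- For d = 1 the logarithm in the sample size can be arbitrarily close to 0, so this case has to
  -- be excluded rather than estimated.
  rcases (show 1 ≤ d from hd).eq_or_lt with rfl | hd2
  · exact absurd hreg
      (DataCopying.not_isRegularityConstant_dim_one p hkreg.1 hε hε1 hnull)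
  · exact fun n hn lam gam hlam hgam _ A => DataCopying.trialLaw_failure_le hd2 p hkreg.1 hε hε1
      hδ hδ1 hreg hnull hn (by linarith) hgam A
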